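/- Let $\mathcal G=(\mathcal V,\mathcal E)$ be a finite connected simple oriented graph, each edge $j\in\mathcal E$ running from $\alpha(j)$ to $\omega(j)$; let $\mathcal E_q$ be the set of edges with endpoint $q$ and $n_q=\#\mathcal E_q$. The exterior vertices ($n_q\le 1$) are split into a nonempty set $\mathcal V_{\mathrm d}$ of damped and a nonempty set $\mathcal V_{\mathrm u}$ of undamped vertices; the other vertices are interior. Given edge lengths $L=(L_j)_{j\in\mathcal E}\in(0,\infty)^{\mathcal E}$ and measurable dampings $\eta_q:\mathbb R\to[0,\infty)$, $q\in\mathcal V_{\mathrm d}$, let $\Sigma_\omega(\mathcal G,L,\eta)$ be the system $$\partial_t^2u_j=\partial_x^2u_j\ \text{ on } [0,L_j]\ (j\in\mathcal E),\qquad u_j(t,q)=u_k(t,q)\ (q\in\mathcal V,\ j,k\in\mathcal E_q),\qquad \sum_{j\in\mathcal E_q}\partial_{n_j}u_j(t,q)=0\ (q \text{ interior}),$$ $$\partial_tu_j(t,q)=-\eta_q(t)\,\partial_{n_j}u_j(t,q)\ (q\in\mathcal V_{\mathrm d},\ j\in\mathcal E_q),\qquad u_j(t,q)=0\ (q\in\mathcal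 V_{\mathrm u},\ j\in\mathcal E_q),$$ for $t\ge0$, where $x=0$ corresponds to $\alpha(j)$, $x=L_j$ to $\omega(j)$, and $\partial_{n_j}$ is the outward derivative. For $p\in[1,+\infty]$ let $\mathsf X_p^\omega=W^{1,p}_0(\mathcal G,L)\times\prod_jL^p([0,L_j],\mathbb C)$, where $W_0^{1,p}(\mathcal G,L)$ is the set of $u\in\prod_jW^{1,p}([0,L_j],\mathbb C)$ that are continuous at the vertices and vanish on $\mathcal V_{\mathrm u}$, with the norm $\|(u,v)\|_p=\big(\sum_j\|u_j'\|_{L^p}^p+\sum_j\|v_j\|_{L^p}^p\big)^{1/p}$ (the maximum of these $L^\infty$ norms if $p=\infty$). Solutions are understood through the d'Alembert decomposition $T(u,v)=f$, $$f_{2j-1}(x)=u_j'(L_j-x)+v_j(L_j-x),\qquad f_{2j}(x)=u_j'(x)-v_j(x):$$ $U:[0,\infty)\to\mathsf X_p^\omega$ is a solution with initial condition $U_0$ if $TU$ coincides for every $t\ge0$, almost everywhere in $x$, with a function $f$ that is constant along the characteristics $x-t=\mathrm{const}$, equals $TU_0$ almost everywhere at $t=0$, and satisfies $f_i(t,0)=\sum_km_{ik}(t)f_k(t,L^\tau_k)$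 for all $t\ge 0$, where $L^\tau_{2j-1}=L^\tau_{2j}=L_j$ and $M(t)=(m_{ik}(t))$ is the matrix that encodes the vertex conditions. Namely $M=-D\big(\sum_{q}M^q\big)D$, $D=\mathrm{diag}((-1)^i)$, with $M^q=(\Pi^q_{\mathrm{out}})^{\mathrm T}C_q\,\Pi^q_{\mathrm{in}}$; here $\Pi^q_{\mathrm{in}}$ and $\Pi^q_{\mathrm{out}}$ are the coordinate projections (with coordinates indexed by $\mathcal E_q$) onto the indices of the waves travelling towards, respectively away from, $q$ (wave $2j-1$ travels from $\omega(j)$ to $\alpha(j)$, wave $2j$ from $\alpha(j)$ to $\omega(j)$), and $C_q=\mathrm{Id}-\frac2{n_q}J_{n_q}$ ($J_n$ the all-ones matrix) if $q$ is interior, $C_q=1$ if $q\in\mathcal V_{\mathrm u}$, $C_q=\frac{1-\eta_q(t)}{1+\eta_q(t)}$ if $q\in\mathcal V_{\mathrm d}$. For a set $\mathcal D$ of dampings $\eta$, the family $\Sigma_\omega(\mathcal G,L,\mathcal D)=\{\Sigma_\omega(\mathcal G,L,\eta):\eta\in\mathcal D\}$ is *exponentially stable in $\mathsf X_p^\omega$*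 if there is $\gamma<0$ such that for every $\varepsilon>0$ there is $K>0$ such that, for every $\eta\in\mathcal D$ and $U_0\in\mathsf X_p^\omega$, the solution $U$ of $\Sigma_\omega(\mathcal G,L,\eta)$ with initial condition $U_0$ satisfies $\|U(t)\|_p\le Ke^{(\gamma+\varepsilon)t}\|U_0\|_p$ for all $t\ge0$. For $\Lambda\in(0,\infty)^{\mathcal E}$, let $V_+(\Lambda)$ be the set of $L\in(0,\infty)^{\mathcal E}$ such that every $n\in\mathbb Z^{\mathcal E}$ with $\sum_j\Lambda_jn_j=0$ satisfies $\sum_jL_jn_j=0$. **Corollary.** Let $\Lambda\in(0,\infty)^{\mathcal E}$, let $\mathfrak D$ be any subset of $[0,\infty)^{\mathcal V_{\mathrm d}}$, and let $\mathcal D=L^\infty(\mathbb R,\mathfrak D)$ be the set of measurable, essentially bounded functions with values in $\mathfrak D$ almost everywhere. The following statements are equivalent: 1. $\Sigma_\omega(\mathcal G,\Lambda,\mathcal D)$ is exponentially stable in $\mathsf X_p^\omega$ for some $p\in[1,+\infty]$. 2. $\Sigma_\omega(\mathcal G,L,\mathcal D)$ is exponentially stable in $\mathsf X_p^\omega$ for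 every $L\in V_+(\Lambda)$ and every $p\in[1,+\infty]$. -/

import Mathlib

open MeasureTheory
open scoped ENNReal

noncomputable section

/-! ### Rational dependence structure of a vector of lengths -/

/-- `Z(Λ)`: the integer relations satisfied by the components of `Λ`. -/
def rationalRelations {ι : Type*} [Fintype ι] (Λ : ι → ℝ) : Set (ι → ℤ) :=
  {n | ∑ i, Λ i * (n i : ℝ) = 0}

/-- `V₊(Λ)`: the vectors with positive components that satisfy every integer relation
satisfied by `Λ`. -/
def VPlus {ι : Type*} [Fintype ι] (Λ : ι → ℝ) : Set (ι → ℝ) :=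
  {L | rationalRelations Λ ⊆ rationalRelations L ∧ ∀ i, 0 < L i}

/-! ### Norms and one-dimensional Sobolev spaces -/

/-- The `ℓ^p` norm of a finite family of extended nonnegative numbers. -/
def lpNormFamily {ι : Type*} [Fintype ι] (p : ℝ≥0∞) (a : ι → ℝ≥0∞) : ℝ≥0∞ :=
  if p = ∞ then ⨆ i, a i else (∑ i, a i ^ p.toReal) ^ (1 / p.toReal)

/-- Lebesgue measure on `[0, ℓ]`. -/
def edgeMeasure (ℓ : ℝ) : Measure ℝ := volume.restrict (Set.Icc 0 ℓ)

/-- `u` is the continuous representative of an element of `W^{1,p}([0, ℓ], ℂ)`: in dimension one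
these are the absolutely continuous functions whose (almost everywhere defined) derivative,
which is also their weak derivative, is in `L^p`. -/
def MemSobolev (p : ℝ≥0∞) (ℓ : ℝ) (u : ℝ → ℂ) : Prop :=
  AbsolutelyContinuousOnInterval u 0 ℓ ∧ MemLp (deriv u) p (edgeMeasure ℓ)

/-! ### Transport systems -/

/-- `f t i x` is an everywhere defined solution of the transport system `∂ₜ fᵢ + ∂ₓ fᵢ = 0` on
`[0, Lᵢ]`, with transmission condition `fᵢ(t, 0) = ∑ⱼ mᵢⱼ(t) fⱼ(t, Lⱼ)` for every `t ≥ 0`: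
it is constant along the characteristics. -/
def IsPointwiseTransportSolution {ι : Type*} [Fintype ι] (L : ι → ℝ) (M : ℝ → Matrix ι ι ℂ)
    (f : ℝ → ι → ℝ → ℂ) : Prop :=
  (∀ i, ∀ t, 0 ≤ t → ∀ x ∈ Set.Icc 0 (L i), ∀ s ∈ Set.Icc (-(min x t)) (L i - x),
    f (t + s) i (x + s) = f t i x) ∧
  ∀ i, ∀ t, 0 ≤ t → f t i 0 = ∑ j, M t i j * f t j (L j)

/-- `F` is a solution of the transport system with initial condition `F₀`, in the sense of
functions of `x` defined up to almost everywhere equality: `F t` coincides almost everywhere, for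
every `t ≥ 0`, with an everywhere defined solution whose value at `t = 0` is `F₀` almost
everywhere. -/
def IsTransportSolution {ι : Type*} [Fintype ι] (L : ι → ℝ) (M : ℝ → Matrix ι ι ℂ)
    (F₀ : ι → ℝ → ℂ) (F : ℝ → ι → ℝ → ℂ) : Prop :=
  ∃ f, IsPointwiseTransportSolution L M f ∧
    (∀ i, f 0 i =ᵐ[edgeMeasure (L i)] F₀ i) ∧
    ∀ t, 0 ≤ t → ∀ i, F t i =ᵐ[edgeMeasure (L i)] f t i

/-! ### Wave propagation on networks -/

/-- A connected oriented graph whose exterior vertices (those with at most one incident edge) are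
divided into damped and undamped ones, with at least one vertex of each kind. -/
structure WaveGraph (V : Type*) where
  graph : SimpleGraph V
  connected : graph.Connected
  /-- The initial endpoint of an edge. -/
  α : graph.edgeSet → V
  /-- The final endpoint of an edge. -/
  ω : graph.edgeSet → V
  orientation : ∀ e : graph.edgeSet, (e : Sym2 V) = s(α e, ω e)
  damped : Set V
  damped_exterior : ∀ q ∈ damped, (graph.incidenceSet q).Subsingleton
  damped_nonempty : damped.Nonempty
  undamped_nonempty : ∃ q, (graph.incidenceSet q).Subsingleton ∧ q ∉ damped

namespace WaveGraph

variable {V : Type*} (N : WaveGraph V)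

/-- The set of edges. -/
def Edge : Type _ := N.graph.edgeSet

instance [Fintype V] : Fintype N.Edge :=
  haveI : Finite N.Edge := inferInstanceAs (Finite N.graph.edgeSet)
  Fintype.ofFinite _

instance : DecidableEq N.Edge := Classical.decEq _

/-- The exterior vertices: those with at most one incident edge. -/
def exterior : Set V := {q | (N.graph.incidenceSet q).Subsingleton}

/-- The undamped vertices: the exterior vertices which are not damped. -/
def undamped : Set V := N.exterior \ N.damped

/-- `𝓔_q`: the set of edges with endpoint `q`. -/
def edgesAt (q : V) : Set N.Edge := {e | q ∈ e.1}

open Classical in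
instance [Fintype V] (q : V) : Fintype (N.edgesAt q) := Fintype.ofFinite _

instance (q : V) : DecidableEq (N.edgesAt q) := Classical.decEq _

open Classical in
/-- The value at the endpoint `q` of the edge `e` of a function on `[0, L_e]`; the point `0`
corresponds to `α(e)` and the point `L_e` to `ω(e)`. -/
def endValue (L : N.Edge → ℝ) (u : N.Edge → ℝ → ℂ) (q : V) (e : N.Edge) : ℂ :=
  if q = N.α e then u e 0 else u e (L e)

/-- The space `W_0^{1,p}(𝓖, L)`: families of `W^{1,p}` functions on the edges, continuous at the
vertices and vanishing at the undamped vertices. -/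
def sobolevSpace (L : N.Edge → ℝ) (p : ℝ≥0∞) : Set (N.Edge → ℝ → ℂ) :=
  {u | (∀ e, MemSobolev p (L e) (u e)) ∧
    (∀ q, ∀ j ∈ N.edgesAt q, ∀ k ∈ N.edgesAt q, N.endValue L u q j = N.endValue L u q k) ∧
    ∀ q ∈ N.undamped, ∀ j ∈ N.edgesAt q, N.endValue L u q j = 0}

/-- Pairs (position, velocity) of families of functions on the edges. -/
def State : Type _ := (N.Edge → ℝ → ℂ) × (N.Edge → ℝ → ℂ)

/-- The space `X_p^ω = W_0^{1,p}(𝓖, L) × L^p(𝓖, L)`; its elements are given by representatives. -/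
def waveSpace (L : N.Edge → ℝ) (p : ℝ≥0∞) : Set N.State :=
  {U | U.1 ∈ N.sobolevSpace L p ∧ ∀ e, MemLp (U.2 e) p (edgeMeasure (L e))}

/-- The norm of `X_p^ω`: the `ℓ^p` norm of the pair `(‖u'‖_{L^p}, ‖v‖_{L^p})`, each of these two
norms being the `ℓ^p` norm over the edges of the `L^p` norms. -/
def waveNorm [Fintype V] (L : N.Edge → ℝ) (p : ℝ≥0∞) (U : N.State) : ℝ≥0∞ :=
  lpNormFamily p ![
    lpNormFamily p fun e : N.Edge => eLpNorm (deriv (U.1 e)) p (edgeMeasure (L e)),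
    lpNormFamily p fun e : N.Edge => eLpNorm (U.2 e) p (edgeMeasure (L e))]

/-- Indices of the travelling waves: `Sum.inl j` stands for the index `2j - 1` (wave moving
from `ω(j)` to `α(j)`), and `Sum.inr j` for the index `2j` (wave moving from `α(j)` to `ω(j)`). -/
abbrev WaveIndex : Type _ := N.Edge ⊕ N.Edge

/-- The lengths `L^τ` of the associated transport system. -/
def transportLength (L : N.Edge → ℝ) : N.WaveIndex → ℝ := Sum.elim L L

/-- The d'Alembert decomposition operator `T`. -/
def dAlembert (L : N.Edge → ℝ) (U : N.State) : N.WaveIndex → ℝ → ℂ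
  | Sum.inl j => fun x => deriv (U.1 j) (L j - x) + U.2 j (L j - x)
  | Sum.inr j => fun x => deriv (U.1 j) x - U.2 j x

/-- The edge on which a wave travels. -/
def waveEdge : N.WaveIndex → N.Edge := Sum.elim id id

/-- The vertex towards which a wave travels. -/
def waveTarget : N.WaveIndex → V
  | Sum.inl j => N.α j
  | Sum.inr j => N.ω j

/-- The vertex from which a wave travels. -/
def waveSource : N.WaveIndex → V
  | Sum.inl j => N.ω j
  | Sum.inr j => N.α j

open Classical in
/-- `Π_in^q`: the projection onto the waves travelling towards `q`, which are indexed by the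
edges with endpoint `q`. -/
def projIn (q : V) : Matrix (N.edgesAt q) N.WaveIndex ℂ :=
  Matrix.of fun e i => if N.waveEdge i = e ∧ N.waveTarget i = q then 1 else 0

open Classical in
/-- `Π_out^q`: the projection onto the waves travelling away from `q`, which are indexed by the
edges with endpoint `q`. -/
def projOut (q : V) : Matrix (N.edgesAt q) N.WaveIndex ℂ :=
  Matrix.of fun e i => if N.waveEdge i = e ∧ N.waveSource i = q then 1 else 0

open Classical in
/-- The matrix `M^q` of the vertex `q`, for the damping values `d`. -/
def vertexMatrix [Fintype V] (d : N.damped → ℝ) (q : V) : Matrix N.WaveIndex N.WaveIndex ℂ :=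
  if h : q ∈ N.damped then
    (((1 - d ⟨q, h⟩) / (1 + d ⟨q, h⟩) : ℝ) : ℂ) • ((N.projOut q).transpose * N.projIn q)
  else if q ∈ N.exterior then
    (N.projOut q).transpose * N.projIn q
  else
    (N.projOut q).transpose *
      (1 - (2 / (Fintype.card (N.edgesAt q) : ℂ)) •
        (Matrix.of fun _ _ => 1 : Matrix (N.edgesAt q) (N.edgesAt q) ℂ)) * N.projIn q

/-- The diagonal matrix `D` with entries `(-1)^i`. -/
def signMatrix : Matrix N.WaveIndex N.WaveIndex ℂ :=
  Matrix.diagonal (Sum.elim (fun _ => -1) fun _ => 1)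

/-- The transmission matrix `M = - D (∑_q M^q) D`, for the damping values `d`. -/
def transmissionMatrix [Fintype V] (d : N.damped → ℝ) : Matrix N.WaveIndex N.WaveIndex ℂ :=
  -(N.signMatrix * (∑ q, N.vertexMatrix d q) * N.signMatrix)

/-- `U` is a solution in `X_p^ω` of the wave system `Σ_ω(𝓖, L, η)` with initial condition `U₀`:
it takes values in `X_p^ω` and its d'Alembert decomposition `T U` solves, with initial
condition `T U₀`, the transport system with transmission matrix `M(t)`. -/
def IsWaveSolution [Fintype V] (L : N.Edge → ℝ) (p : ℝ≥0∞) (η : ℝ → N.damped → ℝ)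
    (U₀ : N.State) (U : ℝ → N.State) : Prop :=
  (∀ t, 0 ≤ t → U t ∈ N.waveSpace L p) ∧
  IsTransportSolution (N.transportLength L) (fun t => N.transmissionMatrix (η t))
    (N.dAlembert L U₀) (fun t => N.dAlembert L (U t))

/-- The family of systems `Σ_ω(𝓖, L, η)`, `η ∈ 𝒟`, is of exponential type `γ` in `X_p^ω`. -/
def IsExponentialType [Fintype V] (L : N.Edge → ℝ) (p : ℝ≥0∞) (𝒟 : Set (ℝ → N.damped → ℝ))
    (γ : ℝ) : Prop :=
  ∀ ε : ℝ, 0 < ε → ∃ K : ℝ, 0 < K ∧ ∀ η ∈ 𝒟, ∀ U₀ ∈ N.waveSpace L p, ∀ U : ℝ → N.State,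
    N.IsWaveSolution L p η U₀ U → ∀ t, 0 ≤ t →
      N.waveNorm L p (U t) ≤ ENNReal.ofReal (K * Real.exp ((γ + ε) * t)) * N.waveNorm L p U₀

/-- The family of systems `Σ_ω(𝓖, L, η)`, `η ∈ 𝒟`, is exponentially stable in `X_p^ω`. -/
def IsExponentiallyStable [Fintype V] (L : N.Edge → ℝ) (p : ℝ≥0∞)
    (𝒟 : Set (ℝ → N.damped → ℝ)) : Prop :=
  ∃ γ : ℝ, γ < 0 ∧ N.IsExponentialType L p 𝒟 γ

/-- `L^∞(ℝ, 𝔇)`: the measurable, essentially bounded dampings that switch arbitrarily in `𝔇`. -/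
def switchingDampings [Fintype V] (𝔇 : Set (N.damped → ℝ)) : Set (ℝ → N.damped → ℝ) :=
  haveI : Fintype N.damped := Fintype.ofFinite _
  {η | MemLp η ∞ (volume : Measure ℝ) ∧ ∀ᵐ t, η t ∈ 𝔇}

end WaveGraph

end

/-!
Exponential stability is a property of the coefficients attached to the *lengths* of paths in the
graph, and lengths that coincide for `Λ` still coincide for `L ∈ V₊(Λ)`.

The d'Alembert decomposition turns a wave into a solution of a transport system, and the traces
`z_k(s) = f_k(s, L_k)` at the exits of the edges solve a linear delay equation `z = d + T z`, where
`d` is the initial datum and `T` is a delay operator (`delayOp`) with coefficients `M(s)`. As all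
traces vanish at negative times, `z` is a finite Neumann sum `∑ T^m d`. Along the orbit of times
`s - L·n`, with `n` a vector of multiplicities of the edges, it is a finite sum of the data
`d_k(s - L·n)`. Grouping the paths according to the value of `Λ·n`, the coefficients are the
contributions of unit data which `HasOrbitDecay` measures: they depend on a choice of damping
values at the points of the orbit, and this choice depends only on `Λ·n`.

* Stability for `Λ` gives `HasOrbitDecay` (`hasOrbitDecay_of_isExponentiallyStable`). A switching
  rule along the orbit is realized by a damping with finitely many values that is constant near the
  relevant times, and a coefficient is read off from the wave whose datum is a narrow bump on one
  edge (`bumpTraces_eq_delaySum`). The bump is odd, hence of mean zero, so that it comes from a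
  position vanishing at all vertices; the transmission conditions then make the wave with these
  exit traces (`waveOfTraces`) stay in the energy space.
* `HasOrbitDecay` gives stability for every `L ∈ V₊(Λ)` and every `p`
  (`isExponentiallyStable_of_hasOrbitDecay`). A damping for `L` induces along the orbit of almost
  every time a choice of damping values that depends only on `Λ·n`
  (`orbitLength_congr`), so `norm_le_of_hasOrbitDecay` bounds the traces pointwise by
  `∑ C exp(κ Λ·n) |d_k(s - L·n)|`. Minkowski's inequality and a geometric series
  (`sum_exp_orbitLength_le`) conclude, since only the `n` with `L·n` close to `s` contribute.

The transport data of waves satisfy linear constraints, but these play no role: the lower bound on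
the side of `Λ` uses data satisfying them, and the upper bound on the side of `L` holds for all data.
-/

noncomputable section

/-! ### Delay operators -/

/-- The operator `(T F)_k(x) = ∑ₗ B(σ_k x)_{kl} F_l(σ_k x)`. When `X` is the set of times and `σ_k`
is the delay `s ↦ s - L_k`, the traces `z_k(s) = f_k(s, L_k)` at the exits of the edges of the
solutions of a transport system are the solutions of `z = d + T z`. -/
def delayOp {X ι : Type*} [Fintype ι] (σ : ι → X → X) (B : X → Matrix ι ι ℂ) :
    (X → ι → ℂ) →ₗ[ℂ] (X → ι → ℂ) where
  toFun F x k := ∑ l, B (σ k x) k l * F (σ k x) l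
  map_add' F G := by
    funext x k
    simp [mul_add, Finset.sum_add_distrib]
  map_smul' c F := by
    funext x k
    simp only [Pi.smul_apply, smul_eq_mul, RingHom.id_apply, Finset.mul_sum]
    exact Finset.sum_congr rfl fun l _ => by ring

/-- The Neumann partial sum `1 + T + ⋯ + T^{N-1}` of a delay operator `T`. -/
def delaySum {X ι : Type*} [Fintype ι] (σ : ι → X → X) (B : X → Matrix ι ι ℂ) (N : ℕ) :
    (X → ι → ℂ) →ₗ[ℂ] (X → ι → ℂ) :=
  ∑ m ∈ Finset.range N, delayOp σ B ^ m

section DelayOp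

variable {X Y ι : Type*} [Fintype ι] {σ : ι → X → X} {B : X → Matrix ι ι ℂ}

theorem delayOp_apply (F : X → ι → ℂ) (x : X) (k : ι) :
    delayOp σ B F x k = ∑ l, B (σ k x) k l * F (σ k x) l := rfl

theorem delayOp_pow_succ_apply (F : X → ι → ℂ) (m : ℕ) (x : X) (k : ι) :
    (delayOp σ B ^ (m + 1)) F x k = ∑ l, B (σ k x) k l * (delayOp σ B ^ m) F (σ k x) l := by
  rw [pow_succ']
  rfl

theorem delaySum_apply (F : X → ι → ℂ) (N : ℕ) (x : X) (k : ι) :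
    delaySum σ B N F x k = ∑ m ∈ Finset.range N, (delayOp σ B ^ m) F x k := by
  simp [delaySum, Finset.sum_apply]

theorem eq_delaySum_add {z d : X → ι → ℂ} (hz : z = d + delayOp σ B z) (N : ℕ) :
    z = delaySum σ B N d + (delayOp σ B ^ N) z := by
  induction N with
  | zero => simp [delaySum]
  | succ N ih =>
    have h : (delayOp σ B ^ N) z = (delayOp σ B ^ N) d + (delayOp σ B ^ (N + 1)) z := by
      conv_lhs => rw [hz]
      rw [map_add, pow_succ]
      rfl
    rw [h] at ih
    conv_lhs => rw [ih]
    simp only [delaySum, Finset.sum_range_succ, LinearMap.add_apply]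
    abel

/-- Powers of delay operators that are intertwined by `π` agree as soon as the coefficients and the
data agree along the finitely many shifts that are used; `R j` stands for the points that are
reached after `j` shifts. -/
theorem delayOp_pow_comp {σ' : ι → Y → Y} {B' : Y → Matrix ι ι ℂ} {F : X → ι → ℂ}
    {F' : Y → ι → ℂ} (π : X → Y) (hπ : ∀ k x, π (σ k x) = σ' k (π x)) (R : ℕ → Set X)
    (hR : ∀ j k, ∀ x ∈ R j, σ k x ∈ R (j + 1)) (N : ℕ)
    (hB : ∀ j ≤ N, ∀ x ∈ R j, B x = B' (π x)) (hF : ∀ j ≤ N, ∀ x ∈ R j, F x = F' (π x))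
    (m j : ℕ) (hmj : j + m ≤ N) (x : X) (hx : x ∈ R j) (k : ι) :
    (delayOp σ B ^ m) F x k = (delayOp σ' B' ^ m) F' (π x) k := by
  induction m generalizing j x k with
  | zero => simp [hF j (by omega) x hx]
  | succ m ih =>
    rw [delayOp_pow_succ_apply, delayOp_pow_succ_apply]
    refine Finset.sum_congr rfl fun l _ => ?_
    rw [ih (j + 1) (by omega) _ (hR j k x hx), hB (j + 1) (by omega) _ (hR j k x hx), hπ]

theorem delayOp_pow_eq_zero {F : X → ι → ℂ} (τ : X → ℝ) {c : ℝ}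
    (hτ : ∀ k x, τ (σ k x) ≤ τ x - c) (hF : ∀ x, τ x < 0 → F x = 0) (m : ℕ) (x : X)
    (hx : τ x < m * c) (k : ι) : (delayOp σ B ^ m) F x k = 0 := by
  induction m generalizing x k with
  | zero => simp [hF x (by simpa using hx)]
  | succ m ih =>
    rw [delayOp_pow_succ_apply]
    refine Finset.sum_eq_zero fun l _ => ?_
    rw [ih _ _ l, mul_zero]
    have := hτ k x
    push_cast at hx
    linarith

theorem delaySum_eq_of_lt {F : X → ι → ℂ} (τ : X → ℝ) {c : ℝ} (hc : 0 ≤ c)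
    (hτ : ∀ k x, τ (σ k x) ≤ τ x - c) (hF : ∀ x, τ x < 0 → F x = 0) {N N' : ℕ} (hN : N ≤ N')
    (x : X) (hx : τ x < N * c) (k : ι) :
    delaySum σ B N' F x k = delaySum σ B N F x k := by
  rw [delaySum_apply, delaySum_apply]
  symm
  refine Finset.sum_subset (Finset.range_mono hN) fun m _ hm => ?_
  refine delayOp_pow_eq_zero τ hτ hF m x (hx.trans_le ?_) k
  have : (N : ℝ) ≤ m := by exact_mod_cast not_lt.1 (by simpa using hm)
  gcongr

/-- A solution of `z = d + T z` that vanishes at negative times is a finite Neumann sum. -/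
theorem eq_delaySum_of_lt {z d : X → ι → ℂ} (hz : z = d + delayOp σ B z) (τ : X → ℝ) {c : ℝ}
    (hτ : ∀ k x, τ (σ k x) ≤ τ x - c) (hF : ∀ x, τ x < 0 → z x = 0) {N : ℕ}
    (x : X) (hx : τ x < N * c) (k : ι) : z x k = delaySum σ B N d x k := by
  conv_lhs => rw [eq_delaySum_add hz N]
  rw [Pi.add_apply, Pi.add_apply, delayOp_pow_eq_zero τ hτ hF N x hx k, add_zero]

end DelayOp

/-- The solution of `z_k(s) = d_k(s) + ∑ₗ M(s - ℓ_k)_{kl} z_l(s - ℓ_k)` by its Neumann series,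
of which the number of nonzero terms at the time `s` is at most `⌊s / c⌋ + 1` if `c` bounds the
delays `ℓ_k` from below and `d` vanishes at negative times. -/
def delaySolution {ι : Type*} [Fintype ι] (ℓ : ι → ℝ) (c : ℝ) (M : ℝ → Matrix ι ι ℂ)
    (d : ℝ → ι → ℂ) (s : ℝ) (k : ι) : ℂ :=
  delaySum (fun k s => s - ℓ k) M (⌊s / c⌋₊ + 1) d s k

section DelaySolution

variable {ι : Type*} [Fintype ι] {ℓ : ι → ℝ} {c : ℝ} {M : ℝ → Matrix ι ι ℂ} {d : ℝ → ι → ℂ}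

theorem delaySolution_eq_delaySum (hc : 0 < c) (hℓ : ∀ k, c ≤ ℓ k)
    (hd : ∀ s, s < 0 → d s = 0) {N : ℕ} {s : ℝ} (hs : s < N * c) (k : ι) :
    delaySolution ℓ c M d s k = delaySum (fun k s => s - ℓ k) M N d s k := by
  have h1 : s < ((⌊s / c⌋₊ + 1 : ℕ) : ℝ) * c := by
    have := Nat.lt_floor_add_one (s / c)
    rw [div_lt_iff₀ hc] at this
    exact_mod_cast this
  have hτ : ∀ k s, s - ℓ k ≤ s - c := fun k s => by linarith [hℓ k]
  rw [delaySolution]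
  rcases le_total N (⌊s / c⌋₊ + 1) with h | h
  · exact delaySum_eq_of_lt (σ := fun k s => s - ℓ k) id hc.le hτ hd h s hs k
  · exact (delaySum_eq_of_lt (σ := fun k s => s - ℓ k) id hc.le hτ hd h s h1 k).symm

theorem delaySolution_of_neg (hc : 0 < c) (hℓ : ∀ k, c ≤ ℓ k)
    (hd : ∀ s, s < 0 → d s = 0) {s : ℝ} (hs : s < 0) (k : ι) :
    delaySolution ℓ c M d s k = 0 := by
  rw [delaySolution_eq_delaySum hc hℓ hd (N := 0) (by simpa using hs)]
  simp [delaySum]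

theorem delaySolution_eq (hc : 0 < c) (hℓ : ∀ k, c ≤ ℓ k)
    (hd : ∀ s, s < 0 → d s = 0) (s : ℝ) (k : ι) :
    delaySolution ℓ c M d s k
      = d s k + ∑ l, M (s - ℓ k) k l * delaySolution ℓ c M d (s - ℓ k) l := by
  obtain ⟨N, hN⟩ := exists_nat_gt (s / c)
  rw [div_lt_iff₀ hc] at hN
  have h1 : s < ((N + 1 : ℕ) : ℝ) * c := by push_cast; linarith
  have h2 : ∀ l, s - ℓ l < N * c := fun l => by linarith [hℓ l]
  rw [delaySolution_eq_delaySum hc hℓ hd h1, delaySum_apply, Finset.sum_range_succ']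
  simp only [delaySolution_eq_delaySum hc hℓ hd (h2 k), delaySum_apply, delayOp_pow_succ_apply,
    Finset.mul_sum]
  rw [Finset.sum_comm, add_comm]
  simp

theorem measurable_delayOp_pow (hM : ∀ k l, Measurable fun s => M s k l)
    (hdm : ∀ k, Measurable fun s => d s k) (m : ℕ) (k : ι) :
    Measurable fun s => (delayOp (fun k s => s - ℓ k) M ^ m) d s k := by
  induction m generalizing k with
  | zero => simpa using hdm k
  | succ m ih =>
    simp only [delayOp_pow_succ_apply]
    refine Finset.measurable_sum _ fun l _ => ?_
    have hs : Measurable fun s : ℝ => s - ℓ k := by fun_prop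
    exact ((hM k l).comp hs).mul ((ih l).comp hs)

theorem measurable_delaySolution (hc : 0 < c) (hℓ : ∀ k, c ≤ ℓ k)
    (hd : ∀ s, s < 0 → d s = 0) (hM : ∀ k l, Measurable fun s => M s k l)
    (hdm : ∀ k, Measurable fun s => d s k) (k : ι) :
    Measurable fun s => delaySolution ℓ c M d s k := by
  refine measurable_of_tendsto_metrizable
    (f := fun (N : ℕ) s => delaySum (fun k s => s - ℓ k) M N d s k) (fun N => ?_) ?_
  · simp only [delaySum_apply]
    exact Finset.measurable_sum _ fun m _ => measurable_delayOp_pow hM hdm m k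
  · rw [tendsto_pi_nhds]
    intro s
    obtain ⟨N, hN⟩ := exists_nat_gt (s / c)
    rw [div_lt_iff₀ hc] at hN
    refine tendsto_const_nhds.congr' ?_
    filter_upwards [Filter.eventually_ge_atTop N] with n hn
    refine delaySolution_eq_delaySum hc hℓ hd (hN.trans_le ?_) k
    have : (N : ℝ) ≤ n := by exact_mod_cast hn
    gcongr

theorem exists_bound_delaySolution (hc : 0 < c) (hℓ : ∀ k, c ≤ ℓ k)
    (hd : ∀ s, s < 0 → d s = 0) {b b' : ℝ} (hM : ∀ s k l, ‖M s k l‖ ≤ b)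
    (hdb : ∀ s k, ‖d s k‖ ≤ b') (T : ℝ) :
    ∃ C, ∀ s ≤ T, ∀ k, ‖delaySolution ℓ c M d s k‖ ≤ C := by
  have key : ∀ m : ℕ, ∃ C, ∀ s k, ‖(delayOp (fun k s => s - ℓ k) M ^ m) d s k‖ ≤ C := by
    intro m
    induction m with
    | zero => exact ⟨b', by simpa using hdb⟩
    | succ m ih =>
      obtain ⟨C, hC⟩ := ih
      refine ⟨∑ _l : ι, b * C, fun s k => ?_⟩
      rw [delayOp_pow_succ_apply]
      refine (norm_sum_le _ _).trans (Finset.sum_le_sum fun l _ => ?_)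
      rw [norm_mul]
      exact mul_le_mul (hM _ _ _) (hC _ _) (norm_nonneg _) ((norm_nonneg _).trans (hM 0 k l))
  choose C hC using key
  obtain ⟨N, hN⟩ := exists_nat_gt (T / c)
  rw [div_lt_iff₀ hc] at hN
  refine ⟨∑ m ∈ Finset.range N, C m, fun s hs k => ?_⟩
  rw [delaySolution_eq_delaySum hc hℓ hd (hs.trans_lt hN), delaySum_apply]
  exact (norm_sum_le _ _).trans (Finset.sum_le_sum fun m _ => hC m s k)

end DelaySolution

/-! ### Locally constant interpolation -/

/-- A function on a finite set of times extends to a measurable function on the line that is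
constant near each of these times and takes finitely many values, one of them prescribed. -/
theorem exists_measurable_eventuallyEq_const {Y : Type*} [MeasurableSpace Y] (y : ℝ → Y) (y₀ : Y)
    (P : Finset ℝ) :
    ∃ η : ℝ → Y, Measurable η ∧ (∀ s, η s ∈ insert y₀ (y '' P)) ∧
      ∀ x ∈ P, ∀ᶠ s in nhds x, η s = y x := by
  classical
  induction P using Finset.induction_on with
  | empty => exact ⟨fun _ => y₀, measurable_const, by simp, by simp⟩
  | insert a P ha ih =>
    obtain ⟨η, hm, hr, he⟩ := ih
    have hopen : ((P : Set ℝ)ᶜ) ∈ nhds a := P.finite_toSet.isClosed.isOpen_compl.mem_nhds ha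
    obtain ⟨ε, hε, hsub⟩ := Metric.nhds_basis_closedBall.mem_iff.1 hopen
    refine ⟨(Metric.closedBall a ε).piecewise (fun _ => y a) η,
      Measurable.piecewise measurableSet_closedBall measurable_const hm, fun s => ?_,
      fun x hx => ?_⟩
    · by_cases hs : s ∈ Metric.closedBall a ε
      · rw [Set.piecewise_eq_of_mem _ _ _ hs]
        exact Or.inr ⟨a, by simp, rfl⟩
      · rw [Set.piecewise_eq_of_notMem _ _ _ hs]
        refine Set.insert_subset_insert (Set.image_mono ?_) (hr s)
        simp
    · rcases Finset.mem_insert.1 hx with rfl | hx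
      · filter_upwards [Metric.closedBall_mem_nhds x hε] with s hs
        rw [Set.piecewise_eq_of_mem _ _ _ hs]
      · have hx' : (Metric.closedBall a ε)ᶜ ∈ nhds x :=
          Metric.isClosed_closedBall.isOpen_compl.mem_nhds fun h => hsub h hx
        filter_upwards [hx', he x hx] with s hs hs'
        rw [Set.piecewise_eq_of_notMem _ _ _ hs, hs']

/-! ### Vertex conditions -/

namespace WaveGraph

variable {V : Type*} (N : WaveGraph V)

theorem α_ne_ω (e : N.Edge) : N.α e ≠ N.ω e := by
  intro h
  have h1 : e.1 = s(N.α e, N.ω e) := N.orientation e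
  have h2 : e.1 ∈ N.graph.edgeSet := e.2
  rw [h1, SimpleGraph.mem_edgeSet, h] at h2
  exact N.graph.irrefl h2

theorem mem_edgesAt_iff {q : V} {e : N.Edge} : e ∈ N.edgesAt q ↔ q = N.α e ∨ q = N.ω e := by
  have h1 : e.1 = s(N.α e, N.ω e) := N.orientation e
  change q ∈ e.1 ↔ _
  rw [h1, Sym2.mem_iff]

open Classical in
/-- The scattering matrix `C_q` of the vertex `q`. -/
def scattering [Fintype V] (d : N.damped → ℝ) (q : V) : Matrix (N.edgesAt q) (N.edgesAt q) ℂ :=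
  if h : q ∈ N.damped then (((1 - d ⟨q, h⟩) / (1 + d ⟨q, h⟩) : ℝ) : ℂ) • 1
  else if q ∈ N.exterior then 1
  else 1 - (2 / (Fintype.card (N.edgesAt q) : ℂ)) •
        (Matrix.of fun _ _ => 1 : Matrix (N.edgesAt q) (N.edgesAt q) ℂ)

theorem vertexMatrix_eq [Fintype V] (d : N.damped → ℝ) (q : V) :
    N.vertexMatrix d q = (N.projOut q).transpose * N.scattering d q * N.projIn q := by
  unfold vertexMatrix scattering
  split_ifs <;> simp

/-- The waves travelling towards the vertex `q`, with the signs of the matrix `D`. -/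
def signedIncoming (a : N.WaveIndex → ℂ) (q : V) (e : N.edgesAt q) : ℂ :=
  open Classical in if q = N.α e.1 then -a (Sum.inl e.1) else a (Sum.inr e.1)

theorem projIn_mulVec [Fintype V] (a : N.WaveIndex → ℂ) (q : V) :
    (N.projIn q).mulVec (N.signMatrix.mulVec a) = N.signedIncoming a q := by
  classical
  funext e
  have hne := N.α_ne_ω e.1
  have key : ∀ (R : N.Edge → Prop) (f : N.Edge → ℂ),
      ∑ x, (if x = e.1 ∧ R x then (1 : ℂ) else 0) * f x = if R e.1 then f e.1 else 0 := by
    intro R f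
    rw [Finset.sum_eq_single e.1]
    · simp
    · intro x _ hx
      simp [hx]
    · simp
  have h1 : (N.projIn q).mulVec (N.signMatrix.mulVec a) e =
      (if N.α e.1 = q then -a (Sum.inl e.1) else 0) + if N.ω e.1 = q then a (Sum.inr e.1) else 0 := by
    rw [← key (fun x => N.α x = q) (fun x => -a (Sum.inl x)),
      ← key (fun x => N.ω x = q) (fun x => a (Sum.inr x)), Matrix.mulVec, dotProduct,
      Fintype.sum_sum_type, signMatrix]
    simp only [Matrix.mulVec_diagonal]
    congr 1 <;> refine Finset.sum_congr rfl fun x _ => ?_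
    · rw [projIn, Matrix.of_apply, Sum.elim_inl, neg_one_mul]
      rfl
    · rw [projIn, Matrix.of_apply, Sum.elim_inr, one_mul]
      rfl
  rw [h1, signedIncoming]
  rcases N.mem_edgesAt_iff.1 e.2 with h | h
  · have h' : ¬ N.ω e.1 = q := fun h' => hne (h.symm.trans h'.symm)
    rw [if_pos h.symm, if_neg h', if_pos h, add_zero]
  · have h' : ¬ q = N.α e.1 := fun h' => hne (h'.symm.trans h)
    rw [if_pos h.symm, if_neg (Ne.symm h'), if_neg h', zero_add]

theorem projOut_transpose_mulVec [Fintype V] (q : V) (y : N.edgesAt q → ℂ) (k : N.WaveIndex)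
    (hk : N.waveEdge k ∈ N.edgesAt q) (hq : N.waveSource k = q) :
    ((N.projOut q).transpose).mulVec y k = y ⟨N.waveEdge k, hk⟩ := by
  classical
  simp only [Matrix.mulVec, dotProduct, projOut, Matrix.transpose_apply, Matrix.of_apply, hq,
    and_true]
  rw [Finset.sum_eq_single ⟨N.waveEdge k, hk⟩]
  · simp
  · intro e _ he
    rw [if_neg fun h => he (Subtype.ext h.symm), zero_mul]
  · simp

theorem projOut_transpose_mulVec_of_ne [Fintype V] (q : V) (y : N.edgesAt q → ℂ)
    (k : N.WaveIndex) (hq : N.waveSource k ≠ q) : ((N.projOut q).transpose).mulVec y k = 0 := by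
  simp [Matrix.mulVec, dotProduct, projOut, hq]

theorem transmissionMatrix_mulVec [Fintype V] (d : N.damped → ℝ) (a : N.WaveIndex → ℂ) (q : V)
    (k : N.WaveIndex) (hk : N.waveEdge k ∈ N.edgesAt q) (hq : N.waveSource k = q) :
    (N.transmissionMatrix d).mulVec a k =
      -((Sum.elim (fun _ => -1) fun _ => 1 : N.WaveIndex → ℂ) k *
        (N.scattering d q).mulVec (N.signedIncoming a q) ⟨N.waveEdge k, hk⟩) := by
  classical
  rw [transmissionMatrix, Matrix.neg_mulVec, Matrix.mul_assoc, ← Matrix.mulVec_mulVec,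
    ← Matrix.mulVec_mulVec, Matrix.sum_mulVec]
  conv_lhs => rw [signMatrix]
  rw [Pi.neg_apply, Matrix.mulVec_diagonal, Finset.sum_apply, Finset.sum_eq_single q]
  · rw [vertexMatrix_eq, ← Matrix.mulVec_mulVec, ← signMatrix, projIn_mulVec,
      ← Matrix.mulVec_mulVec, projOut_transpose_mulVec N q _ k hk hq]
  · intro q' _ hq'
    rw [vertexMatrix_eq, Matrix.mul_assoc, ← Matrix.mulVec_mulVec,
      projOut_transpose_mulVec_of_ne N q' _ k (by rw [hq]; exact hq'.symm)]
  · simp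

open Classical in
/-- Twice the velocity at the endpoint `q` of the edge `e` of the wave with exit traces `a` and
entrance traces `b`. -/
def traceJump (a b : N.WaveIndex → ℂ) (q : V) (e : N.Edge) : ℂ :=
  if q = N.α e then a (Sum.inl e) - b (Sum.inr e) else b (Sum.inl e) - a (Sum.inr e)

theorem traceJump_eq [Fintype V] (d : N.damped → ℝ) (a : N.WaveIndex → ℂ) (q : V)
    (e : N.edgesAt q) :
    N.traceJump a ((N.transmissionMatrix d).mulVec a) q e.1 =
      (N.scattering d q).mulVec (N.signedIncoming a q) e - N.signedIncoming a q e := by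
  classical
  have hne := N.α_ne_ω e.1
  unfold traceJump
  conv_rhs => rw [signedIncoming]
  rcases N.mem_edgesAt_iff.1 e.2 with h | h
  · rw [if_pos h, if_pos h, transmissionMatrix_mulVec N d a q (Sum.inr e.1) e.2 h.symm]
    simp [waveEdge]
    ring
  · have h' : ¬ q = N.α e.1 := fun h' => hne (h'.symm.trans h)
    rw [if_neg h', if_neg h', transmissionMatrix_mulVec N d a q (Sum.inl e.1) e.2 h.symm]
    simp [waveEdge]

theorem traceJump_eq_zero [Fintype V] (d : N.damped → ℝ) (a : N.WaveIndex → ℂ) {q : V}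
    (hq : q ∈ N.undamped) {e : N.Edge} (he : e ∈ N.edgesAt q) :
    N.traceJump a ((N.transmissionMatrix d).mulVec a) q e = 0 := by
  have := traceJump_eq N d a q ⟨e, he⟩
  rw [this, scattering, dif_neg hq.2, if_pos hq.1]
  simp

theorem eq_of_mem_exterior {q : V} (hq : q ∈ N.exterior) {e e' : N.Edge} (he : e ∈ N.edgesAt q)
    (he' : e' ∈ N.edgesAt q) : e = e' :=
  Subtype.ext (hq (x := e.1) ⟨e.2, he⟩ (y := e'.1) ⟨e'.2, he'⟩)

theorem traceJump_congr [Fintype V] (d : N.damped → ℝ) (a : N.WaveIndex → ℂ) {q : V}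
    {e e' : N.Edge} (he : e ∈ N.edgesAt q) (he' : e' ∈ N.edgesAt q) :
    N.traceJump a ((N.transmissionMatrix d).mulVec a) q e =
      N.traceJump a ((N.transmissionMatrix d).mulVec a) q e' := by
  by_cases hq : q ∈ N.exterior
  · rw [N.eq_of_mem_exterior hq he he']
  · have hd : q ∉ N.damped := fun h => hq (N.damped_exterior q h)
    rw [traceJump_eq N d a q ⟨e, he⟩, traceJump_eq N d a q ⟨e', he'⟩, scattering, dif_neg hd,
      if_neg hq]
    rw [Matrix.sub_mulVec, Matrix.one_mulVec, Matrix.smul_mulVec]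
    simp [Matrix.mulVec, dotProduct]

end WaveGraph

/-! ### Norms of states and of travelling waves -/

theorem lpNormFamily_le_sum {ι : Type*} [Fintype ι] {p : ℝ≥0∞} (hp : 1 ≤ p) (a : ι → ℝ≥0∞) :
    lpNormFamily p a ≤ ∑ i, a i := by
  unfold lpNormFamily
  split_ifs with h
  · exact iSup_le fun i => Finset.single_le_sum (fun _ _ => zero_le) (Finset.mem_univ i)
  · have hp1 : 1 ≤ p.toReal := by
      rw [← ENNReal.toReal_one]
      exact ENNReal.toReal_mono h hp
    have hp0 : 0 < p.toReal := by linarith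
    rw [one_div, ENNReal.rpow_inv_le_iff hp0]
    classical
    refine Finset.induction_on (motive := fun s => ∑ i ∈ s, a i ^ p.toReal ≤
      (∑ i ∈ s, a i) ^ p.toReal) _ (by simp [hp0]) fun i s hi ih => ?_
    rw [Finset.sum_insert hi, Finset.sum_insert hi]
    exact (add_le_add_right ih _).trans (ENNReal.add_rpow_le_rpow_add _ _ hp1)

theorem le_lpNormFamily {ι : Type*} [Fintype ι] {p : ℝ≥0∞} (hp : 1 ≤ p) (a : ι → ℝ≥0∞) (i : ι) :
    a i ≤ lpNormFamily p a := by
  unfold lpNormFamily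
  split_ifs with h
  · exact le_iSup a i
  · have hp0 : 0 < p.toReal := ENNReal.toReal_pos (one_pos.trans_le hp).ne' h
    rw [one_div, ENNReal.le_rpow_inv_iff hp0]
    exact Finset.single_le_sum (f := fun i => a i ^ p.toReal) (fun _ _ => zero_le)
      (Finset.mem_univ i)

theorem measurePreserving_edgeMeasure_sub (ℓ : ℝ) :
    MeasurePreserving (fun x => ℓ - x) (edgeMeasure ℓ) (edgeMeasure ℓ) := by
  have h := (Measure.measurePreserving_sub_left (volume : Measure ℝ) ℓ).restrict_preimage
    (measurableSet_Icc (a := (0 : ℝ)) (b := ℓ))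
  have h2 : (fun x => ℓ - x) ⁻¹' Set.Icc 0 ℓ = Set.Icc 0 ℓ := by
    ext x
    simp only [Set.mem_preimage, Set.mem_Icc]
    constructor <;> rintro ⟨h1, h2⟩ <;> constructor <;> linarith
  rw [h2] at h
  exact h

namespace WaveGraph

variable {V : Type*} (N : WaveGraph V) {L : N.Edge → ℝ} {p : ℝ≥0∞}

theorem memLp_dAlembert {U : N.State} (hU : U ∈ N.waveSpace L p) (k : N.WaveIndex) :
    MemLp (N.dAlembert L U k) p (edgeMeasure (N.transportLength L k)) := by
  cases k with
  | inl e =>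
    exact (((hU.1.1 e).2.add (hU.2 e)).comp_measurePreserving
      (measurePreserving_edgeMeasure_sub (L e)) :)
  | inr e => exact (((hU.1.1 e).2.sub (hU.2 e)) :)

variable [Fintype V]

theorem waveNorm_le_sum (hp : 1 ≤ p) (U : N.State) :
    N.waveNorm L p U ≤ ∑ e : N.Edge, (eLpNorm (deriv (U.1 e)) p (edgeMeasure (L e)) +
      eLpNorm (U.2 e) p (edgeMeasure (L e))) := by
  refine (lpNormFamily_le_sum hp _).trans ?_
  rw [Fin.sum_univ_two, Finset.sum_add_distrib]
  exact add_le_add (lpNormFamily_le_sum hp _) (lpNormFamily_le_sum hp _)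

theorem eLpNorm_deriv_le_waveNorm (hp : 1 ≤ p) (U : N.State) (e : N.Edge) :
    eLpNorm (deriv (U.1 e)) p (edgeMeasure (L e)) ≤ N.waveNorm L p U :=
  (le_lpNormFamily hp (fun e : N.Edge => eLpNorm (deriv (U.1 e)) p (edgeMeasure (L e))) e).trans
    (le_lpNormFamily hp _ 0)

theorem eLpNorm_snd_le_waveNorm (hp : 1 ≤ p) (U : N.State) (e : N.Edge) :
    eLpNorm (U.2 e) p (edgeMeasure (L e)) ≤ N.waveNorm L p U :=
  (le_lpNormFamily hp (fun e : N.Edge => eLpNorm (U.2 e) p (edgeMeasure (L e))) e).trans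
    (le_lpNormFamily hp _ 1)

theorem eLpNorm_dAlembert_le (hp : 1 ≤ p) {U : N.State} (hU : U ∈ N.waveSpace L p)
    (k : N.WaveIndex) :
    eLpNorm (N.dAlembert L U k) p (edgeMeasure (N.transportLength L k)) ≤
      2 * N.waveNorm L p U := by
  rw [two_mul]
  cases k with
  | inl e =>
    have h1 : eLpNorm (N.dAlembert L U (Sum.inl e)) p (edgeMeasure (L e)) =
        eLpNorm (deriv (U.1 e) + U.2 e) p (edgeMeasure (L e)) :=
      eLpNorm_comp_measurePreserving ((hU.1.1 e).2.add (hU.2 e)).1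
        (measurePreserving_edgeMeasure_sub (L e))
    refine (h1.le.trans (eLpNorm_add_le (hU.1.1 e).2.1 (hU.2 e).1 hp)).trans ?_
    exact add_le_add (N.eLpNorm_deriv_le_waveNorm hp U e) (N.eLpNorm_snd_le_waveNorm hp U e)
  | inr e =>
    refine (eLpNorm_sub_le (hU.1.1 e).2.1 (hU.2 e).1 hp).trans ?_
    exact add_le_add (N.eLpNorm_deriv_le_waveNorm hp U e) (N.eLpNorm_snd_le_waveNorm hp U e)

theorem waveNorm_le_dAlembert (hp : 1 ≤ p) {U : N.State} (hU : U ∈ N.waveSpace L p) :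
    N.waveNorm L p U ≤ 2 * ∑ k : N.WaveIndex,
      eLpNorm (N.dAlembert L U k) p (edgeMeasure (N.transportLength L k)) := by
  refine (N.waveNorm_le_sum hp U).trans ?_
  rw [Fintype.sum_sum_type, ← Finset.sum_add_distrib, Finset.mul_sum]
  refine Finset.sum_le_sum fun e _ => ?_
  have hl := N.memLp_dAlembert hU (Sum.inl e)
  have hr := N.memLp_dAlembert hU (Sum.inr e)
  change MemLp _ p (edgeMeasure (L e)) at hl hr
  have hP := measurePreserving_edgeMeasure_sub (L e)
  have hl' := hl.comp_measurePreserving hP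
  have hn : eLpNorm (N.dAlembert L U (Sum.inl e) ∘ fun x => L e - x) p (edgeMeasure (L e)) =
      eLpNorm (N.dAlembert L U (Sum.inl e)) p (edgeMeasure (L e)) :=
    eLpNorm_comp_measurePreserving hl.1 hP
  have hhalf : ‖(1 / 2 : ℂ)‖ₑ ≤ 1 := by
    rw [← ofReal_norm, ENNReal.ofReal_le_one]
    norm_num
  have h1 : deriv (U.1 e) = (1 / 2 : ℂ) • ((N.dAlembert L U (Sum.inl e) ∘ fun x => L e - x) +
      N.dAlembert L U (Sum.inr e)) := by
    funext x
    simp [dAlembert]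
    ring
  have h2 : U.2 e = (1 / 2 : ℂ) • ((N.dAlembert L U (Sum.inl e) ∘ fun x => L e - x) -
      N.dAlembert L U (Sum.inr e)) := by
    funext x
    simp [dAlembert]
    ring
  rw [two_mul]
  refine add_le_add ?_ ?_
  · rw [h1, eLpNorm_const_smul]
    refine (mul_le_mul_left hhalf _).trans ?_
    rw [one_mul]
    exact (eLpNorm_add_le hl'.1 hr.1 hp).trans (by rw [hn]; rfl)
  · rw [h2, eLpNorm_const_smul]
    refine (mul_le_mul_left hhalf _).trans ?_
    rw [one_mul]
    exact (eLpNorm_sub_le hl'.1 hr.1 hp).trans (by rw [hn]; rfl)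

end WaveGraph

namespace WaveGraph

variable {V : Type*} (N : WaveGraph V)

theorem transportLength_eq (L : N.Edge → ℝ) (k : N.WaveIndex) :
    N.transportLength L k = L (N.waveEdge k) := by cases k <;> rfl

theorem le_transportLength {L : N.Edge → ℝ} {c : ℝ} (hc : ∀ e, c ≤ L e) (k : N.WaveIndex) :
    c ≤ N.transportLength L k := by
  rw [transportLength_eq]
  exact hc _

variable [Fintype V]

/-! ### Orbits of the delays -/

/-- The total length of a multiplicity vector of edges. -/
def orbitLength (L : N.Edge → ℝ) (o : N.Edge → ℕ) : ℝ := ∑ e, L e * o e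

/-- The multiplicity vector after one more passage along the edge of the wave `k`. -/
def orbitShift (k : N.WaveIndex) (o : N.Edge → ℕ) : N.Edge → ℕ := o + Pi.single (N.waveEdge k) 1

/-- A unit datum in the component `k`, placed at all the multiplicity vectors whose `Λ`-length is
that of `n`. -/
def orbitDelta (Λ : N.Edge → ℝ) (n : N.Edge → ℕ) (k : N.WaveIndex) (o : N.Edge → ℕ)
    (k' : N.WaveIndex) : ℂ :=
  open Classical in if k' = k ∧ N.orbitLength Λ o = N.orbitLength Λ n then 1 else 0

/-- The switching rule `y` chooses damping values in `𝔇` along the orbit, and two multiplicity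
vectors of the same `Λ`-length are given the same value. -/
def IsOrbitSwitching (Λ : N.Edge → ℝ) (𝔇 : Set (N.damped → ℝ))
    (y : (N.Edge → ℕ) → N.damped → ℝ) : Prop :=
  (∀ o, y o ∈ 𝔇) ∧ ∀ o o', N.orbitLength Λ o = N.orbitLength Λ o' → y o = y o'

/-- The contribution of a unit datum, carried by the paths whose multiplicity vectors have the
`Λ`-length of `n`, is at most `C exp(κ Λ·n)`, uniformly with respect to the switching rule. -/
def HasOrbitDecay (Λ : N.Edge → ℝ) (𝔇 : Set (N.damped → ℝ)) (C κ : ℝ) : Prop :=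
  ∀ (n : N.Edge → ℕ) (k : N.WaveIndex), ∃ m₀ : ℕ, ∀ m ≥ m₀, ∀ y, N.IsOrbitSwitching Λ 𝔇 y → ∀ i,
    ‖delaySum N.orbitShift (fun o => N.transmissionMatrix (y o)) m (N.orbitDelta Λ n k) 0 i‖ ≤
      C * Real.exp (κ * N.orbitLength Λ n)

theorem orbitLength_zero (L : N.Edge → ℝ) : N.orbitLength L 0 = 0 := by simp [orbitLength]

theorem orbitLength_shift (L : N.Edge → ℝ) (k : N.WaveIndex) (o : N.Edge → ℕ) :
    N.orbitLength L (N.orbitShift k o) = N.orbitLength L o + L (N.waveEdge k) := by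
  have h : ∀ e, ((Pi.single (N.waveEdge k) 1 : N.Edge → ℕ) e : ℝ) =
      if e = N.waveEdge k then 1 else 0 := fun e => by
    simp [Pi.single_apply]
  simp [orbitLength, orbitShift, mul_add, Finset.sum_add_distrib, h]

theorem orbitLength_nonneg {L : N.Edge → ℝ} (hL : ∀ e, 0 < L e) (o : N.Edge → ℕ) :
    0 ≤ N.orbitLength L o :=
  Finset.sum_nonneg fun e _ => mul_nonneg (hL e).le (Nat.cast_nonneg _)

theorem mul_le_orbitLength {L : N.Edge → ℝ} (hL : ∀ e, 0 < L e) (o : N.Edge → ℕ) (e : N.Edge) :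
    L e * o e ≤ N.orbitLength L o :=
  Finset.single_le_sum (f := fun e => L e * (o e : ℝ))
    (fun e _ => mul_nonneg (hL e).le (Nat.cast_nonneg _)) (Finset.mem_univ e)

/-- Passing from `Λ` to `L ∈ V₊(Λ)` creates no new distinctions between lengths. -/
theorem orbitLength_congr {Λ L : N.Edge → ℝ} (hL : L ∈ VPlus Λ) {o o' : N.Edge → ℕ}
    (h : N.orbitLength Λ o = N.orbitLength Λ o') : N.orbitLength L o = N.orbitLength L o' := by
  have key : ∀ M : N.Edge → ℝ, ∑ e, M e * (((o e : ℤ) - (o' e : ℤ) : ℤ) : ℝ) =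
      N.orbitLength M o - N.orbitLength M o' := fun M => by
    simp [orbitLength, mul_sub, Finset.sum_sub_distrib]
  have h1 : (fun e => (o e : ℤ) - (o' e : ℤ)) ∈ rationalRelations Λ := by
    rw [rationalRelations, Set.mem_ofPred_eq, key, h, sub_self]
  have h2 := hL.1 h1
  rw [rationalRelations, Set.mem_ofPred_eq, key] at h2
  linarith

theorem exists_pos_le {L : N.Edge → ℝ} (hL : ∀ e, 0 < L e) : ∃ c, 0 < c ∧ ∀ e, c ≤ L e := by
  cases isEmpty_or_nonempty N.Edge with
  | inl h => exact ⟨1, one_pos, fun e => h.elim e⟩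
  | inr h =>
    obtain ⟨e₀, he₀⟩ := Finite.exists_min L
    exact ⟨L e₀, hL e₀, he₀⟩

theorem exists_orbitBox {L : N.Edge → ℝ} (hL : ∀ e, 0 < L e) (T : ℝ) :
    ∃ m : ℕ, ∀ o : N.Edge → ℕ, N.orbitLength L o ≤ T →
      o ∈ Fintype.piFinset fun _ : N.Edge => Finset.range m := by
  obtain ⟨c, hc, hcL⟩ := N.exists_pos_le hL
  obtain ⟨m, hm⟩ := exists_nat_gt (T / c)
  rw [div_lt_iff₀ hc] at hm
  refine ⟨m, fun o ho => Fintype.mem_piFinset.2 fun e => Finset.mem_range.2 ?_⟩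
  have h1 := N.mul_le_orbitLength hL o e
  have h2 : c * (o e : ℝ) ≤ L e * o e := mul_le_mul_of_nonneg_right (hcL e) (Nat.cast_nonneg _)
  have h3 : (o e : ℝ) * c < m * c := by linarith
  exact_mod_cast lt_of_mul_lt_mul_right h3 hc.le

theorem sum_exp_orbitLength_le {Λ : N.Edge → ℝ} (hΛ : ∀ e, 0 < Λ e) {κ : ℝ} (hκ : κ < 0) (m : ℕ) :
    ∑ o ∈ Fintype.piFinset fun _ : N.Edge => Finset.range m, Real.exp (κ * N.orbitLength Λ o) ≤
      ∏ e, (1 - Real.exp (κ * Λ e))⁻¹ := by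
  have h1 : ∀ o : N.Edge → ℕ, Real.exp (κ * N.orbitLength Λ o) =
      ∏ e, Real.exp (κ * Λ e) ^ o e := fun o => by
    rw [orbitLength, Finset.mul_sum, Real.exp_sum]
    refine Finset.prod_congr rfl fun e _ => ?_
    rw [← Real.exp_nat_mul]
    ring_nf
  simp only [h1]
  rw [← Finset.prod_univ_sum (fun _ : N.Edge => Finset.range m)
    (fun e j => Real.exp (κ * Λ e) ^ j)]
  refine Finset.prod_le_prod (fun e _ => Finset.sum_nonneg fun j _ => by positivity) fun e _ => ?_
  have hlt : Real.exp (κ * Λ e) < 1 := by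
    rw [Real.exp_lt_one_iff]
    exact mul_neg_of_neg_of_pos hκ (hΛ e)
  rw [← tsum_geometric_of_lt_one (Real.exp_pos _).le hlt]
  exact (summable_geometric_of_lt_one (Real.exp_pos _).le hlt).sum_le_tsum _
    fun j _ => by positivity

/-- Pointwise form of the transfer of decay from `Λ` to `L ∈ V₊(Λ)`: the exit traces at the time `s`
are a combination of the data at the times `s - L·n`, whose coefficients are contributions of unit
data in the sense of `HasOrbitDecay` since lengths that agree for `Λ` agree for `L`. -/
theorem norm_le_of_hasOrbitDecay {Λ L : N.Edge → ℝ} (hL : L ∈ VPlus Λ) {𝔇 : Set (N.damped → ℝ)}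
    {C κ : ℝ} (hC : 0 ≤ C) (h : N.HasOrbitDecay Λ 𝔇 C κ) {η : ℝ → N.damped → ℝ}
    {z d : ℝ → N.WaveIndex → ℂ} (hz0 : ∀ s, s < 0 → z s = 0) (hd0 : ∀ s, s < 0 → d s = 0)
    (hz : ∀ s k, z s k = d s k + ∑ l, N.transmissionMatrix (η (s - N.transportLength L k)) k l *
      z (s - N.transportLength L k) l) (s : ℝ) (hη : ∀ o, η (s - N.orbitLength L o) ∈ 𝔇)
    (S : Finset (N.Edge → ℕ)) (hS : ∀ o, N.orbitLength L o ≤ s → o ∈ S) (i : N.WaveIndex) :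
    ‖z s i‖ ≤ ∑ n ∈ S, ∑ k, C * Real.exp (κ * N.orbitLength Λ n) *
      ‖d (s - N.orbitLength L n) k‖ := by
  classical
  set y : (N.Edge → ℕ) → N.damped → ℝ := fun o => η (s - N.orbitLength L o) with hy
  have hsw : N.IsOrbitSwitching Λ 𝔇 y :=
    ⟨hη, fun o o' ho => by simp only [hy, N.orbitLength_congr hL ho]⟩
  set B : (N.Edge → ℕ) → Matrix N.WaveIndex N.WaveIndex ℂ := fun o => N.transmissionMatrix (y o)
  set zo : (N.Edge → ℕ) → N.WaveIndex → ℂ := fun o => z (s - N.orbitLength L o) with hzo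
  set dO : (N.Edge → ℕ) → N.WaveIndex → ℂ := fun o => d (s - N.orbitLength L o) with hdO
  have heq : zo = dO + delayOp N.orbitShift B zo := by
    funext o k
    rw [Pi.add_apply, Pi.add_apply, delayOp_apply]
    simp only [hzo, hdO, B, hy]
    rw [hz, N.orbitLength_shift, N.transportLength_eq, sub_sub]
  obtain ⟨c, hc, hcL⟩ := N.exists_pos_le hL.2
  obtain ⟨m₁, hm₁⟩ := exists_nat_gt (s / c)
  rw [div_lt_iff₀ hc] at hm₁
  choose m₀ hm₀ using h
  set m := m₁ + ∑ n ∈ S, ∑ k, m₀ n k with hm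
  have hm1m : (m₁ : ℝ) ≤ m := by exact_mod_cast Nat.le_add_right _ _
  have hzsum : z s i = delaySum N.orbitShift B m dO 0 i := by
    have := eq_delaySum_of_lt heq (fun o => s - N.orbitLength L o) (c := c) (N := m)
      (fun k o => by
        have := hcL (N.waveEdge k)
        rw [N.orbitLength_shift]
        linarith)
      (fun o ho => hz0 _ ho) 0
      (by
        rw [N.orbitLength_zero]
        have : (m₁ : ℝ) * c ≤ m * c := mul_le_mul_of_nonneg_right hm1m hc.le
        linarith) i
    rw [← this]
    simp [hzo, N.orbitLength_zero]
  -- one representative for each value of the `Λ`-length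
  obtain ⟨S', hS', hbij⟩ := Set.exists_subset_bijOn (S : Set (N.Edge → ℕ)) (N.orbitLength Λ)
  have hfin : S'.Finite := S.finite_toSet.subset hS'
  lift S' to Finset (N.Edge → ℕ) using hfin
  have hdecomp : dO = ∑ n ∈ S', ∑ k, dO n k • N.orbitDelta Λ n k := by
    funext o k
    simp only [Finset.sum_apply, Pi.smul_apply, smul_eq_mul, orbitDelta]
    have hk : ∀ n : N.Edge → ℕ, ∑ k', dO n k' * (if k = k' ∧ N.orbitLength Λ o =
        N.orbitLength Λ n then (1 : ℂ) else 0) =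
        if N.orbitLength Λ o = N.orbitLength Λ n then dO n k else 0 := fun n => by
      rw [Finset.sum_eq_single k]
      · simp
      · intro k' _ hk'
        simp [hk'.symm]
      · simp
    simp only [hk]
    have hcl : ∀ n, N.orbitLength Λ o = N.orbitLength Λ n → dO n k = dO o k := fun n hn => by
      simp only [hdO, N.orbitLength_congr hL hn]
    by_cases ho : o ∈ S
    · obtain ⟨n, hn, hno⟩ := hbij.surjOn ⟨o, ho, rfl⟩
      rw [Finset.sum_eq_single n]
      · rw [if_pos hno.symm, hcl n hno.symm]
      · intro n' hn' hne
        rw [if_neg]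
        intro h'
        exact hne (hbij.injOn hn' hn (h'.symm.trans hno.symm))
      · exact fun hn' => absurd hn hn'
    · have h0 : dO o k = 0 := by
        have : d (s - N.orbitLength L o) = 0 :=
          hd0 _ (by linarith [not_le.1 fun h' => ho (hS o h')])
        simp only [hdO, this, Pi.zero_apply]
      rw [h0]
      refine (Finset.sum_eq_zero fun n _ => ?_).symm
      split_ifs with hn
      · rw [hcl n hn, h0]
      · rfl
  rw [hzsum, hdecomp]
  simp only [map_sum, map_smul, Finset.sum_apply, Pi.smul_apply]
  refine (norm_sum_le _ _).trans ?_
  have hsub : S' ⊆ S := by exact_mod_cast hS'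
  refine le_trans ?_ (Finset.sum_le_sum_of_subset_of_nonneg hsub fun n _ _ =>
    Finset.sum_nonneg fun k _ => by positivity)
  refine Finset.sum_le_sum fun n hn => (norm_sum_le _ _).trans (Finset.sum_le_sum fun k _ => ?_)
  rw [norm_smul, mul_comm]
  refine mul_le_mul_of_nonneg_right (hm₀ n k m ?_ y hsw i) (norm_nonneg _)
  calc m₀ n k ≤ ∑ k, m₀ n k :=
        Finset.single_le_sum (f := fun k => m₀ n k) (fun _ _ => Nat.zero_le _) (Finset.mem_univ k)
    _ ≤ ∑ n ∈ S, ∑ k, m₀ n k :=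
        Finset.single_le_sum (f := fun n => ∑ k, m₀ n k) (fun _ _ => Nat.zero_le _) (hsub hn)
    _ ≤ m := Nat.le_add_left _ _

end WaveGraph

namespace WaveGraph

variable {V : Type*} (N : WaveGraph V) [Fintype V]

/-! ### From the decay along orbits to exponential stability -/

/-- The trace at the exit of the wave `k`, extended by zero to negative times. -/
def exitTrace (L : N.Edge → ℝ) (f : ℝ → N.WaveIndex → ℝ → ℂ) (s : ℝ) (k : N.WaveIndex) : ℂ :=
  if 0 ≤ s then f s k (N.transportLength L k) else 0

variable {L : N.Edge → ℝ} {M : ℝ → Matrix N.WaveIndex N.WaveIndex ℂ}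
  {f : ℝ → N.WaveIndex → ℝ → ℂ}

omit [Fintype V] in
theorem transportLength_pos (hL : ∀ e, 0 < L e) (k : N.WaveIndex) : 0 < N.transportLength L k := by
  rw [transportLength_eq]
  exact hL _

theorem exitTrace_eq_of_mem (hf : IsPointwiseTransportSolution (N.transportLength L) M f)
    {t : ℝ} (ht : 0 ≤ t) (k : N.WaveIndex) {x : ℝ} (hx : x ∈ Set.Icc 0 (N.transportLength L k)) :
    N.exitTrace L f (t + N.transportLength L k - x) k = f t k x := by
  have h1 := hf.1 k t ht x hx (N.transportLength L k - x)
    ⟨by have := le_min hx.1 ht; linarith [hx.2], le_rfl⟩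
  rw [exitTrace, if_pos (by linarith [hx.2]), ← h1]
  congr 1 <;> ring

theorem exitTrace_eq (hL : ∀ e, 0 < L e)
    (hf : IsPointwiseTransportSolution (N.transportLength L) M f) (s : ℝ) (k : N.WaveIndex) :
    N.exitTrace L f s k = (if s < N.transportLength L k then N.exitTrace L f s k else 0) +
      ∑ l, M (s - N.transportLength L k) k l * N.exitTrace L f (s - N.transportLength L k) l := by
  have hk := N.transportLength_pos hL k
  split_ifs with hs
  · have h0 : ∀ l, N.exitTrace L f (s - N.transportLength L k) l = 0 := fun l =>
      if_neg (by linarith)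
    simp [h0]
  · have ht : 0 ≤ s - N.transportLength L k := by linarith
    have h1 := N.exitTrace_eq_of_mem hf ht k (x := 0) ⟨le_rfl, hk.le⟩
    rw [sub_add_cancel, sub_zero] at h1
    rw [h1, hf.2 k _ ht, zero_add]
    refine Finset.sum_congr rfl fun l _ => ?_
    rw [exitTrace, if_pos ht]

/-- The data read at the exit of the wave `k` before the first passage through the edge. -/
def exitDatum (L : N.Edge → ℝ) (f : ℝ → N.WaveIndex → ℝ → ℂ) (s : ℝ) (k : N.WaveIndex) : ℂ :=
  if s < N.transportLength L k then N.exitTrace L f s k else 0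

theorem exitDatum_eq_indicator (hf : IsPointwiseTransportSolution (N.transportLength L) M f)
    (k : N.WaveIndex) :
    (fun s => N.exitDatum L f s k) = (Set.Ico 0 (N.transportLength L k)).indicator
      (f 0 k ∘ fun x => N.transportLength L k - x) := by
  classical
  funext s
  rw [Set.indicator_apply, exitDatum]
  by_cases h0 : 0 ≤ s
  · by_cases h1 : s < N.transportLength L k
    · rw [if_pos h1, if_pos ⟨h0, h1⟩]
      have := N.exitTrace_eq_of_mem hf le_rfl k (x := N.transportLength L k - s)
        ⟨by linarith, by linarith⟩
      rw [zero_add, sub_sub_cancel] at this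
      exact this
    · rw [if_neg h1, if_neg fun h => h1 h.2]
  · have hs : s ∉ Set.Ico 0 (N.transportLength L k) := fun h => h0 h.1
    rw [exitTrace, if_neg h0, ite_self, if_neg hs]

theorem aestronglyMeasurable_exitDatum
    (hf : IsPointwiseTransportSolution (N.transportLength L) M f) (k : N.WaveIndex)
    (hm : AEStronglyMeasurable (f 0 k) (edgeMeasure (N.transportLength L k))) :
    AEStronglyMeasurable (fun s => N.exitDatum L f s k) volume := by
  rw [N.exitDatum_eq_indicator hf k, aestronglyMeasurable_indicator_iff measurableSet_Ico]
  exact (hm.comp_measurePreserving (measurePreserving_edgeMeasure_sub _)).mono_measure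
    (Measure.restrict_mono Set.Ico_subset_Icc_self le_rfl)

theorem eLpNorm_exitDatum (hf : IsPointwiseTransportSolution (N.transportLength L) M f)
    (k : N.WaveIndex) (p : ℝ≥0∞)
    (hm : AEStronglyMeasurable (f 0 k) (edgeMeasure (N.transportLength L k))) :
    eLpNorm (fun s => N.exitDatum L f s k) p volume =
      eLpNorm (f 0 k) p (edgeMeasure (N.transportLength L k)) := by
  rw [N.exitDatum_eq_indicator hf k, eLpNorm_indicator_eq_eLpNorm_restrict measurableSet_Ico,
    Measure.restrict_congr_set Ico_ae_eq_Icc]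
  exact eLpNorm_comp_measurePreserving hm (measurePreserving_edgeMeasure_sub _)

omit [Fintype V] in
theorem ae_forall_orbit {𝔇 : Set (N.damped → ℝ)} {η : ℝ → N.damped → ℝ}
    (hη : ∀ᵐ t, η t ∈ 𝔇) {ι : Type*} [Countable ι] (τ : ι → ℝ) :
    ∀ᵐ s, ∀ o, η (s - τ o) ∈ 𝔇 := by
  rw [ae_all_iff]
  intro o
  exact (measurePreserving_sub_right volume (τ o)).quasiMeasurePreserving.ae hη

/-- The `L^p` form of `norm_le_of_hasOrbitDecay`. One half of the exponential weight gives the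
decay in time, the other one makes the sum over the multiplicity vectors converge. -/
theorem eLpNorm_transport_le {Λ : N.Edge → ℝ} (hΛ : ∀ e, 0 < Λ e) (hL : L ∈ VPlus Λ)
    {𝔇 : Set (N.damped → ℝ)} {C κ c : ℝ} (hC : 0 ≤ C) (hκ : κ < 0)
    (hc : ∀ e, c * L e ≤ Λ e) (hc0 : 0 ≤ c) (h : N.HasOrbitDecay Λ 𝔇 C κ)
    {η : ℝ → N.damped → ℝ} (hη : ∀ᵐ t, η t ∈ 𝔇)
    (hf : IsPointwiseTransportSolution (N.transportLength L)
      (fun t => N.transmissionMatrix (η t)) f) {p : ℝ≥0∞} (hp : 1 ≤ p)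
    (hm : ∀ k, AEStronglyMeasurable (f 0 k) (edgeMeasure (N.transportLength L k)))
    {t : ℝ} (ht : 0 ≤ t) (i : N.WaveIndex) :
    eLpNorm (f t i) p (edgeMeasure (N.transportLength L i)) ≤
      ENNReal.ofReal (C * (∏ e, (1 - Real.exp (κ / 2 * Λ e))⁻¹) *
        Real.exp (κ / 2 * (c * (t - ∑ e, L e)))) *
      ∑ k, eLpNorm (f 0 k) p (edgeMeasure (N.transportLength L k)) := by
  have hLpos := hL.2
  have hLe : ∀ k, N.transportLength L k ≤ ∑ e, L e := fun k => by
    rw [transportLength_eq]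
    exact Finset.single_le_sum (fun e _ => (hLpos e).le) (Finset.mem_univ _)
  obtain ⟨m, hbox⟩ := N.exists_orbitBox hLpos (t + N.transportLength L i)
  set S := Fintype.piFinset fun _ : N.Edge => Finset.range m with hS
  set w : (N.Edge → ℕ) → ℝ := fun n => C * (Real.exp (κ / 2 * N.orbitLength Λ n) *
    Real.exp (κ / 2 * (c * (t - ∑ e, L e)))) with hw
  have hw0 : ∀ n, 0 ≤ w n := fun n => by positivity
  set d := N.exitDatum L f with hd
  -- at the time `s` only the multiplicity vectors `n` with `L·n > s - L_k` carry data
  have hweight : ∀ (n : N.Edge → ℕ) (k : N.WaveIndex) (s : ℝ), t ≤ s →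
      C * Real.exp (κ * N.orbitLength Λ n) * ‖d (s - N.orbitLength L n) k‖ ≤
        w n * ‖d (s - N.orbitLength L n) k‖ := by
    intro n k s hs
    by_cases hlt : s - N.orbitLength L n < N.transportLength L k
    · refine mul_le_mul_of_nonneg_right ?_ (norm_nonneg _)
      refine mul_le_mul_of_nonneg_left ?_ hC
      rw [← Real.exp_add, Real.exp_le_exp]
      have h1 : c * N.orbitLength L n ≤ N.orbitLength Λ n := by
        rw [orbitLength, orbitLength, Finset.mul_sum]
        refine Finset.sum_le_sum fun e _ => ?_
        rw [← mul_assoc]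
        exact mul_le_mul_of_nonneg_right (hc e) (Nat.cast_nonneg _)
      have h2 : t - ∑ e, L e ≤ N.orbitLength L n := by linarith [hLe k]
      have h3 : c * (t - ∑ e, L e) ≤ N.orbitLength Λ n :=
        (mul_le_mul_of_nonneg_left h2 hc0).trans h1
      nlinarith
    · have : d (s - N.orbitLength L n) k = 0 := if_neg hlt
      simp [this]
  have hmp : ∀ n, MeasurePreserving
      (fun x : ℝ => t + N.transportLength L i - N.orbitLength L n - x) volume volume := fun n =>
    Measure.measurePreserving_sub_left volume _
  set g : (N.Edge → ℕ) → N.WaveIndex → ℝ → ℝ := fun n k x =>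
    w n * ‖d (t + N.transportLength L i - N.orbitLength L n - x) k‖ with hg
  have hgm : ∀ n k, AEStronglyMeasurable (g n k) volume := fun n k =>
    (((N.aestronglyMeasurable_exitDatum hf k (hm k)).comp_measurePreserving
      (hmp n)).norm.const_mul (w n) :)
  have hgnorm : ∀ n k, eLpNorm (g n k) p volume = ENNReal.ofReal (w n) *
      eLpNorm (f 0 k) p (edgeMeasure (N.transportLength L k)) := fun n k => by
    have h1 : g n k = w n • fun x =>
        ‖((fun s => d s k) ∘ fun x => t + N.transportLength L i - N.orbitLength L n - x) x‖ := rfl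
    rw [h1, eLpNorm_const_smul, eLpNorm_norm,
      eLpNorm_comp_measurePreserving (N.aestronglyMeasurable_exitDatum hf k (hm k)) (hmp n),
      N.eLpNorm_exitDatum hf k p (hm k), Real.enorm_eq_ofReal (hw0 n)]
  have hae : ∀ᵐ x ∂edgeMeasure (N.transportLength L i),
      ‖f t i x‖ ≤ ‖(∑ n ∈ S, ∑ k, g n k) x‖ := by
    have h1 : ∀ᵐ x : ℝ, ∀ o, η (t + N.transportLength L i - x - N.orbitLength L o) ∈ 𝔇 :=
      (Measure.measurePreserving_sub_left volume
        (t + N.transportLength L i)).quasiMeasurePreserving.ae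
        (N.ae_forall_orbit hη (N.orbitLength L))
    filter_upwards [ae_restrict_of_ae h1, ae_restrict_mem measurableSet_Icc] with x hx hxm
    rw [← N.exitTrace_eq_of_mem hf ht i hxm]
    refine le_trans ?_ (le_abs_self _)
    refine (N.norm_le_of_hasOrbitDecay hL hC h (z := N.exitTrace L f) (d := d)
      (fun s hs => funext fun k => if_neg (not_le.2 hs)) (fun s hs => funext fun k => ?_)
      (fun s k => N.exitTrace_eq hLpos hf s k) _ hx S
      (fun o ho => hbox o (by linarith [hxm.1])) i).trans ?_
    · simp only [hd, exitDatum, exitTrace, if_neg (not_le.2 hs), ite_self, Pi.zero_apply]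
    · rw [Finset.sum_apply]
      refine Finset.sum_le_sum fun n _ => ?_
      rw [Finset.sum_apply]
      refine Finset.sum_le_sum fun k _ => (hweight n k _ (by linarith [hxm.2])).trans_eq ?_
      simp only [hg]
      rw [sub_right_comm]
  calc eLpNorm (f t i) p (edgeMeasure (N.transportLength L i))
      ≤ eLpNorm (∑ n ∈ S, ∑ k, g n k) p (edgeMeasure (N.transportLength L i)) :=
        eLpNorm_mono_ae hae
    _ ≤ eLpNorm (∑ n ∈ S, ∑ k, g n k) p volume := eLpNorm_mono_measure _ Measure.restrict_le_self
    _ ≤ ∑ n ∈ S, ∑ k, eLpNorm (g n k) p volume :=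
        (eLpNorm_sum_le (fun n _ => Finset.aestronglyMeasurable_sum _ fun k _ => hgm n k) hp).trans
          (Finset.sum_le_sum fun n _ => eLpNorm_sum_le (fun k _ => hgm n k) hp)
    _ = ENNReal.ofReal (∑ n ∈ S, w n) *
          ∑ k, eLpNorm (f 0 k) p (edgeMeasure (N.transportLength L k)) := by
        rw [ENNReal.ofReal_sum_of_nonneg fun n _ => hw0 n, Finset.sum_mul]
        refine Finset.sum_congr rfl fun n _ => ?_
        rw [Finset.mul_sum]
        exact Finset.sum_congr rfl fun k _ => hgnorm n k
    _ ≤ _ := by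
        refine mul_le_mul_left (ENNReal.ofReal_le_ofReal ?_) _
        simp only [hw]
        rw [← Finset.mul_sum, ← Finset.sum_mul, mul_assoc]
        refine mul_le_mul_of_nonneg_left ?_ hC
        exact mul_le_mul_of_nonneg_right (N.sum_exp_orbitLength_le hΛ (by linarith) m)
          (Real.exp_pos _).le

theorem isExponentiallyStable_of_hasOrbitDecay {Λ : N.Edge → ℝ} (hΛ : ∀ e, 0 < Λ e)
    (hL : L ∈ VPlus Λ) {𝔇 : Set (N.damped → ℝ)} {C κ : ℝ} (hC : 0 ≤ C) (hκ : κ < 0)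
    (h : N.HasOrbitDecay Λ 𝔇 C κ) {p : ℝ≥0∞} (hp : 1 ≤ p) :
    N.IsExponentiallyStable L p (N.switchingDampings 𝔇) := by
  obtain ⟨c, hc0, hc⟩ := N.exists_pos_le (L := fun e => Λ e / L e)
    fun e => div_pos (hΛ e) (hL.2 e)
  have hc' : ∀ e, c * L e ≤ Λ e := fun e => (le_div_iff₀ (hL.2 e)).1 (hc e)
  refine ⟨κ / 2 * c, mul_neg_of_neg_of_pos (by linarith) hc0, fun ε hε => ?_⟩
  set I : ℝ := (Fintype.card N.WaveIndex : ℝ)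
  set P : ℝ := ∏ e, (1 - Real.exp (κ / 2 * Λ e))⁻¹
  have hP : 0 ≤ P := Finset.prod_nonneg fun e _ => by
    rw [inv_nonneg, sub_nonneg, Real.exp_le_one_iff]
    exact (mul_neg_of_neg_of_pos (by linarith) (hΛ e)).le
  have hI : 0 ≤ I := Nat.cast_nonneg _
  set K : ℝ := 4 * I * I * (C * P * Real.exp (-(κ / 2 * (c * ∑ e, L e)))) with hK
  have hK0 : 0 ≤ K := by positivity
  refine ⟨K + 1, by linarith, fun η hη U₀ hU₀ U hU t ht => ?_⟩
  obtain ⟨f, hf, hf0, hft⟩ := hU.2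
  have hm : ∀ k, AEStronglyMeasurable (f 0 k) (edgeMeasure (N.transportLength L k)) := fun k =>
    (N.memLp_dAlembert hU₀ k).1.congr (hf0 k).symm
  set E : ℝ := C * P * Real.exp (κ / 2 * (c * (t - ∑ e, L e))) with hE
  have hstep : ∀ i, eLpNorm (N.dAlembert L (U t) i) p (edgeMeasure (N.transportLength L i)) ≤
      ENNReal.ofReal E * ∑ _k : N.WaveIndex, 2 * N.waveNorm L p U₀ := fun i => by
    rw [eLpNorm_congr_ae (hft t ht i)]
    refine (N.eLpNorm_transport_le hΛ hL hC hκ hc' hc0.le h hη.2 hf hp hm ht i).trans ?_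
    refine mul_le_mul_right (Finset.sum_le_sum fun k _ => ?_) _
    rw [eLpNorm_congr_ae (hf0 k)]
    exact N.eLpNorm_dAlembert_le hp hU₀ k
  calc N.waveNorm L p (U t)
      ≤ 2 * ∑ i, eLpNorm (N.dAlembert L (U t) i) p (edgeMeasure (N.transportLength L i)) :=
        N.waveNorm_le_dAlembert hp (hU.1 t ht)
    _ ≤ 2 * ∑ _i : N.WaveIndex, ENNReal.ofReal E * ∑ _k : N.WaveIndex, 2 * N.waveNorm L p U₀ :=
        mul_le_mul_right (Finset.sum_le_sum fun i _ => hstep i) _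
    _ = ENNReal.ofReal (4 * I * I * E) * N.waveNorm L p U₀ := by
        simp only [Finset.sum_const, Finset.card_univ, nsmul_eq_mul]
        rw [ENNReal.ofReal_mul (p := 4 * I * I) (by positivity),
          ENNReal.ofReal_mul (p := 4 * I) (by positivity),
          ENNReal.ofReal_mul (p := 4) (by positivity), ENNReal.ofReal_natCast]
        rw [show ENNReal.ofReal 4 = 2 * 2 by norm_num]
        ring
    _ ≤ _ := by
        refine mul_le_mul_left (ENNReal.ofReal_le_ofReal ?_) _
        have h1 : 4 * I * I * E = K * Real.exp (κ / 2 * c * t) := by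
          rw [hE, hK, show κ / 2 * (c * (t - ∑ e, L e)) =
            -(κ / 2 * (c * ∑ e, L e)) + κ / 2 * c * t by ring, Real.exp_add]
          ring
        rw [h1]
        refine mul_le_mul (by linarith) (Real.exp_le_exp.2 ?_) (Real.exp_pos _).le (by linarith)
        nlinarith

end WaveGraph

namespace WaveGraph

variable {V : Type*} (N : WaveGraph V)

/-! ### Waves with prescribed exit traces -/

/-- The wave whose exit traces are `z`: its velocity is `(z_{2j-1}(t+x) - z_{2j}(t+L_j-x)) / 2` and
its position is obtained from the primitives of the traces. -/
def waveOfTraces (L : N.Edge → ℝ) (z : ℝ → N.WaveIndex → ℂ) (t : ℝ) : N.State :=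
  (fun e x => ((∫ s in 0..(t + x), z s (Sum.inl e)) -
      ∫ s in 0..(t + L e - x), z s (Sum.inr e)) / 2,
    fun e x => (z (t + x) (Sum.inl e) - z (t + L e - x) (Sum.inr e)) / 2)

/-- Exit traces of waves: measurable, bounded on bounded-above sets of times, zero at negative
times, satisfying the transmission conditions, and with data of mean zero on each edge. -/
structure IsTraceFamily [Fintype V] (L : N.Edge → ℝ) (η : ℝ → N.damped → ℝ)
    (z : ℝ → N.WaveIndex → ℂ) : Prop where
  measurable : ∀ k, Measurable fun s => z s k
  bounded : ∀ T, ∃ C, ∀ s ≤ T, ∀ k, ‖z s k‖ ≤ C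
  transmission : ∀ s, 0 ≤ s → ∀ k,
    z (s + N.transportLength L k) k = (N.transmissionMatrix (η s)).mulVec (z s) k
  mean : ∀ k, ∫ s in 0..N.transportLength L k, z s k = 0

namespace IsTraceFamily

variable {N} [Fintype V] {L : N.Edge → ℝ} {η : ℝ → N.damped → ℝ} {z : ℝ → N.WaveIndex → ℂ}

theorem intervalIntegrable (hz : N.IsTraceFamily L η z) (k : N.WaveIndex) (a b : ℝ) :
    IntervalIntegrable (fun s => z s k) volume a b := by
  obtain ⟨C, hC⟩ := hz.bounded (max a b)
  rw [intervalIntegrable_iff]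
  refine Measure.integrableOn_of_bounded (M := C) (by simp)
    (hz.measurable k).aestronglyMeasurable ?_
  filter_upwards [ae_restrict_mem measurableSet_uIoc] with s hs
  exact hC s hs.2 k

theorem locallyIntegrable (hz : N.IsTraceFamily L η z) (k : N.WaveIndex) :
    LocallyIntegrable (fun s => z s k) volume := by
  rw [locallyIntegrable_iff]
  intro K hK
  obtain ⟨T, hT⟩ := hK.bddAbove
  obtain ⟨C, hC⟩ := hz.bounded T
  refine Measure.integrableOn_of_bounded (M := C) hK.measure_lt_top.ne
    (hz.measurable k).aestronglyMeasurable ?_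
  filter_upwards [ae_restrict_mem hK.measurableSet] with s hs
  exact hC s (hT hs) k

theorem norm_integral_sub_le (hz : N.IsTraceFamily L η z) (k : N.WaveIndex) {T C : ℝ}
    (hC : ∀ s ≤ T, ∀ k, ‖z s k‖ ≤ C) {a b : ℝ} (ha : a ≤ T) (hb : b ≤ T) :
    ‖(∫ s in 0..a, z s k) - ∫ s in 0..b, z s k‖ ≤ C * |a - b| := by
  rw [intervalIntegral.integral_interval_sub_left (hz.intervalIntegrable k _ _)
    (hz.intervalIntegrable k _ _)]
  refine intervalIntegral.norm_integral_le_of_norm_le_const fun s hs => hC s ?_ k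
  exact hs.2.trans (max_le hb ha)

theorem integral_add_transportLength (hz : N.IsTraceFamily L η z) (k : N.WaveIndex) (t : ℝ) :
    ∫ s in 0..(t + N.transportLength L k), z s k =
      ∫ s in 0..t, z (s + N.transportLength L k) k := by
  rw [← intervalIntegral.integral_add_adjacent_intervals
    (hz.intervalIntegrable k 0 (N.transportLength L k)) (hz.intervalIntegrable k _ _), hz.mean,
    zero_add, intervalIntegral.integral_comp_add_right (fun s => z s k), zero_add]

/-- The value of the wave at a vertex is the integral of its velocity there, since it vanishes at
the vertices at the time `0`. -/
theorem endValue_eq (hz : N.IsTraceFamily L η z) {t : ℝ} (ht : 0 ≤ t) (q : V) (e : N.Edge) :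
    N.endValue L (N.waveOfTraces L z t).1 q e = (∫ s in 0..t,
      N.traceJump (z s) ((N.transmissionMatrix (η s)).mulVec (z s)) q e) / 2 := by
  have hcongr : ∫ s in 0..t, N.traceJump (z s) ((N.transmissionMatrix (η s)).mulVec (z s)) q e =
      ∫ s in 0..t, N.traceJump (z s) (fun k => z (s + N.transportLength L k) k) q e := by
    refine intervalIntegral.integral_congr fun s hs => ?_
    rw [Set.uIcc_of_le ht] at hs
    have : (N.transmissionMatrix (η s)).mulVec (z s) =
        fun k => z (s + N.transportLength L k) k :=
      funext fun k => (hz.transmission s hs.1 k).symm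
    simp only [this]
  have hi : ∀ k, IntervalIntegrable (fun s => z (s + N.transportLength L k) k) volume 0 t :=
    fun k => by
      have := (hz.intervalIntegrable k (N.transportLength L k)
        (t + N.transportLength L k)).comp_add_right (N.transportLength L k)
      simpa using this
  have hl := hz.integral_add_transportLength (Sum.inl e) t
  have hr := hz.integral_add_transportLength (Sum.inr e) t
  have hil : IntervalIntegrable (fun s => z (s + L e) (Sum.inl e)) volume 0 t := hi (Sum.inl e)
  have hir : IntervalIntegrable (fun s => z (s + L e) (Sum.inr e)) volume 0 t := hi (Sum.inr e)
  simp only [transportLength, Sum.elim_inl, Sum.elim_inr] at hl hr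
  rw [hcongr]
  unfold endValue traceJump
  split_ifs with h
  · change _ = (∫ s in 0..t, (z s (Sum.inl e) - z (s + L e) (Sum.inr e))) / 2
    rw [intervalIntegral.integral_sub (hz.intervalIntegrable _ _ _) hir, ← hr]
    simp only [waveOfTraces, add_zero, sub_zero]
  · change _ = (∫ s in 0..t, (z (s + L e) (Sum.inl e) - z s (Sum.inr e))) / 2
    rw [intervalIntegral.integral_sub hil (hz.intervalIntegrable _ _ _), ← hl]
    simp only [waveOfTraces, add_sub_cancel_right]

theorem ae_deriv_eq (hz : N.IsTraceFamily L η z) (t : ℝ) (e : N.Edge) :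
    ∀ᵐ x, deriv ((N.waveOfTraces L z t).1 e) x =
      (z (t + x) (Sum.inl e) + z (t + L e - x) (Sum.inr e)) / 2 := by
  have h1 := (measurePreserving_add_left volume t).quasiMeasurePreserving.ae
    (LocallyIntegrable.ae_hasDerivAt_integral (hz.locallyIntegrable (Sum.inl e)))
  have h2 := (Measure.measurePreserving_sub_left volume (t + L e)).quasiMeasurePreserving.ae
    (LocallyIntegrable.ae_hasDerivAt_integral (hz.locallyIntegrable (Sum.inr e)))
  filter_upwards [h1, h2] with x hx1 hx2
  have h3 := (hx1 0).comp_const_add t x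
  have h4 := (hx2 0).comp_const_sub (t + L e) x
  refine (((h3.sub h4).div_const 2).congr_deriv ?_).deriv
  rw [sub_neg_eq_add]

theorem memLp_trace_comp (hz : N.IsTraceFamily L η z) (p : ℝ≥0∞) (k : N.WaveIndex)
    (g : ℝ → ℝ) (hg : Measurable g) {ℓ T : ℝ} (hT : ∀ x ∈ Set.Icc 0 ℓ, g x ≤ T) :
    MemLp (fun x => z (g x) k) p (edgeMeasure ℓ) := by
  obtain ⟨C, hC⟩ := hz.bounded T
  have : IsFiniteMeasure (edgeMeasure ℓ) := by
    unfold edgeMeasure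
    infer_instance
  refine MemLp.of_bound ((hz.measurable k).comp hg).aestronglyMeasurable C ?_
  filter_upwards [ae_restrict_mem measurableSet_Icc] with x hx
  exact hC _ (hT x hx) k

theorem memSobolev (hz : N.IsTraceFamily L η z) (hL : ∀ e, 0 < L e) (t : ℝ) (p : ℝ≥0∞)
    (e : N.Edge) : MemSobolev p (L e) ((N.waveOfTraces L z t).1 e) := by
  constructor
  · obtain ⟨C, hC⟩ := hz.bounded (t + L e)
    refine LipschitzOnWith.absolutelyContinuousOnInterval (K := C.toNNReal) ?_
    rw [Set.uIcc_of_le (hL e).le]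
    refine LipschitzOnWith.of_dist_le_mul fun x hx x' hx' => ?_
    have hC0 : 0 ≤ C := (norm_nonneg _).trans (hC _ le_rfl (Sum.inl e))
    rw [Real.coe_toNNReal _ hC0, dist_eq_norm, Real.dist_eq]
    have h1 := hz.norm_integral_sub_le (Sum.inl e) hC (a := t + x) (b := t + x')
      (by linarith [hx.2]) (by linarith [hx'.2])
    have h2 := hz.norm_integral_sub_le (Sum.inr e) hC (a := t + L e - x) (b := t + L e - x')
      (by linarith [hx.1]) (by linarith [hx'.1])
    rw [show t + x - (t + x') = x - x' by ring] at h1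
    rw [show t + L e - x - (t + L e - x') = -(x - x') by ring, abs_neg] at h2
    have h3 : (N.waveOfTraces L z t).1 e x - (N.waveOfTraces L z t).1 e x' =
        (((∫ s in 0..(t + x), z s (Sum.inl e)) - ∫ s in 0..(t + x'), z s (Sum.inl e)) -
        ((∫ s in 0..(t + L e - x), z s (Sum.inr e)) -
          ∫ s in 0..(t + L e - x'), z s (Sum.inr e))) / 2 := by
      simp only [waveOfTraces]
      ring
    rw [h3, norm_div, Complex.norm_ofNat, div_le_iff₀ two_pos]
    linarith [norm_sub_le ((∫ s in 0..(t + x), z s (Sum.inl e)) -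
        ∫ s in 0..(t + x'), z s (Sum.inl e)) ((∫ s in 0..(t + L e - x), z s (Sum.inr e)) -
          ∫ s in 0..(t + L e - x'), z s (Sum.inr e))]
  · have h1 := hz.memLp_trace_comp p (Sum.inl e) (fun x => t + x) (by fun_prop) (ℓ := L e)
      (T := t + L e) fun x hx => by linarith [hx.2]
    have h2 := hz.memLp_trace_comp p (Sum.inr e) (fun x => t + L e - x) (by fun_prop) (ℓ := L e)
      (T := t + L e) fun x hx => by linarith [hx.1]
    refine ((h1.add h2).const_mul (2⁻¹ : ℂ)).ae_eq ?_
    filter_upwards [ae_restrict_of_ae (hz.ae_deriv_eq t e)] with x hx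
    rw [hx, Pi.add_apply]
    ring

theorem waveOfTraces_mem (hz : N.IsTraceFamily L η z) (hL : ∀ e, 0 < L e) {t : ℝ} (ht : 0 ≤ t)
    (p : ℝ≥0∞) : N.waveOfTraces L z t ∈ N.waveSpace L p := by
  refine ⟨⟨hz.memSobolev hL t p, fun q j hj k hk => ?_, fun q hq j hj => ?_⟩, fun e => ?_⟩
  · rw [hz.endValue_eq ht, hz.endValue_eq ht]
    simp only [N.traceJump_congr _ _ hj hk]
  · rw [hz.endValue_eq ht]
    simp only [N.traceJump_eq_zero _ _ hq hj, intervalIntegral.integral_zero, zero_div]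
  · have h1 := hz.memLp_trace_comp p (Sum.inl e) (fun x => t + x) (by fun_prop) (ℓ := L e)
      (T := t + L e) fun x hx => by linarith [hx.2]
    have h2 := hz.memLp_trace_comp p (Sum.inr e) (fun x => t + L e - x) (by fun_prop) (ℓ := L e)
      (T := t + L e) fun x hx => by linarith [hx.1]
    refine ((h1.sub h2).const_mul (2⁻¹ : ℂ)).ae_eq (Filter.Eventually.of_forall fun x => ?_)
    simp only [waveOfTraces, Pi.sub_apply]
    ring

theorem dAlembert_waveOfTraces (hz : N.IsTraceFamily L η z) (t : ℝ) (k : N.WaveIndex) :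
    N.dAlembert L (N.waveOfTraces L z t) k =ᵐ[edgeMeasure (N.transportLength L k)]
      fun x => z (t + N.transportLength L k - x) k := by
  refine ae_restrict_of_ae ?_
  cases k with
  | inl e =>
    filter_upwards [(Measure.measurePreserving_sub_left volume
      (L e)).quasiMeasurePreserving.ae (hz.ae_deriv_eq t e)] with x hx
    simp only [dAlembert, hx, transportLength, Sum.elim_inl]
    simp only [waveOfTraces, add_sub_assoc]
    ring
  | inr e =>
    filter_upwards [hz.ae_deriv_eq t e] with x hx
    simp only [dAlembert, hx, transportLength, Sum.elim_inr]
    simp only [waveOfTraces]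
    ring

theorem isWaveSolution (hz : N.IsTraceFamily L η z) (hL : ∀ e, 0 < L e) (p : ℝ≥0∞) :
    N.IsWaveSolution L p η (N.waveOfTraces L z 0) (N.waveOfTraces L z) := by
  refine ⟨fun t ht => hz.waveOfTraces_mem hL ht p,
    fun t k x => z (t + N.transportLength L k - x) k, ⟨fun k t _ x _ s _ => ?_, fun k t ht => ?_⟩,
    fun k => (hz.dAlembert_waveOfTraces 0 k).symm, fun t _ k => hz.dAlembert_waveOfTraces t k⟩
  · change z _ k = z _ k
    rw [show t + s + N.transportLength L k - (x + s) = t + N.transportLength L k - x by ring]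
  · simp only [sub_zero, add_sub_cancel_right]
    exact hz.transmission t ht k

end IsTraceFamily

end WaveGraph

/-! ### Odd bumps -/

/-- The odd function `τ ↦ τ` cut off outside of `(-δ, δ)`. -/
def oddBump (δ : ℝ) : ℝ → ℂ := (Set.Ioo (-δ) δ).indicator fun τ => (τ : ℂ)

theorem oddBump_of_abs_lt {δ τ : ℝ} (h : |τ| < δ) : oddBump δ τ = τ :=
  Set.indicator_of_mem (s := Set.Ioo (-δ) δ) (abs_lt.1 h) _

theorem oddBump_of_le_abs {δ τ : ℝ} (h : δ ≤ |τ|) : oddBump δ τ = 0 :=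
  Set.indicator_of_notMem (s := Set.Ioo (-δ) δ) (fun h' => (abs_lt.2 h').not_ge h) _

theorem oddBump_neg (δ τ : ℝ) : oddBump δ (-τ) = -oddBump δ τ := by
  rcases lt_or_ge |τ| δ with h | h
  · rw [oddBump_of_abs_lt h, oddBump_of_abs_lt (by rwa [abs_neg]), Complex.ofReal_neg]
  · rw [oddBump_of_le_abs h, oddBump_of_le_abs (by rwa [abs_neg]), neg_zero]

theorem measurable_oddBump (δ : ℝ) : Measurable (oddBump δ) :=
  Complex.measurable_ofReal.indicator measurableSet_Ioo

theorem norm_oddBump_le {δ : ℝ} (hδ : 0 < δ) (τ : ℝ) : ‖oddBump δ τ‖ ≤ δ := by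
  rcases lt_or_ge |τ| δ with h | h
  · rw [oddBump_of_abs_lt h, Complex.norm_real]
    exact h.le
  · rw [oddBump_of_le_abs h, norm_zero]
    exact hδ.le

theorem integral_oddBump (δ a : ℝ) : ∫ τ in (-a)..a, oddBump δ τ = 0 := by
  have h := intervalIntegral.integral_comp_neg (a := -a) (b := a) (oddBump δ)
  simp only [oddBump_neg, intervalIntegral.integral_neg, neg_neg] at h
  exact self_eq_neg.1 h.symm

theorem memLp_oddBump (δ : ℝ) (p : ℝ≥0∞) : MemLp (oddBump δ) p volume := by
  rw [oddBump, memLp_indicator_iff_restrict measurableSet_Ioo]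
  refine MemLp.of_bound Complex.measurable_ofReal.aestronglyMeasurable δ ?_
  filter_upwards [ae_restrict_mem measurableSet_Ioo] with τ hτ
  rw [Complex.norm_real]
  exact (abs_lt.2 hτ).le

theorem eLpNorm_oddBump_ne_zero {δ : ℝ} (hδ : 0 < δ) {p : ℝ≥0∞} (hp : p ≠ 0) :
    eLpNorm (oddBump δ) p volume ≠ 0 := by
  rw [Ne, eLpNorm_eq_zero_iff (memLp_oddBump δ p).1 hp]
  intro h
  have h1 : volume (Set.Ioo 0 δ) = 0 := by
    refine measure_mono_null (fun τ hτ => ?_) (ae_iff.1 h)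
    change ¬ oddBump δ τ = 0
    rw [oddBump_of_abs_lt (by rw [abs_of_pos hτ.1]; exact hτ.2)]
    exact_mod_cast hτ.1.ne'
  rw [Real.volume_Ioo, sub_zero, ENNReal.ofReal_eq_zero] at h1
  linarith

namespace WaveGraph

variable {V : Type*} (N : WaveGraph V) [Fintype V]

/-! ### From exponential stability to the decay along orbits -/

/-- The exit traces with datum a bump of odd profile in the middle of the edge of the wave `k`. -/
def bumpTraces (Λ : N.Edge → ℝ) (c : ℝ) (η : ℝ → N.damped → ℝ) (δ : ℝ) (k : N.WaveIndex) :
    ℝ → N.WaveIndex → ℂ :=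
  delaySolution (N.transportLength Λ) c (fun s => N.transmissionMatrix (η s))
    fun s k' => open Classical in
      if k' = k then oddBump δ (s - N.transportLength Λ k / 2) else 0

section BumpTraces

variable {N} {Λ : N.Edge → ℝ} {c δ : ℝ} {η : ℝ → N.damped → ℝ} {k : N.WaveIndex}

omit [Fintype V] in
theorem bumpDatum_of_neg (hc0 : 0 < c) (hc : ∀ e, c ≤ Λ e) (hδ : 2 * δ ≤ c) {s : ℝ} (hs : s < 0) :
    (fun k' : N.WaveIndex => open Classical in
      if k' = k then oddBump δ (s - N.transportLength Λ k / 2) else 0) = 0 := by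
  funext k'
  have := N.le_transportLength hc k
  rw [oddBump_of_le_abs, ite_self]
  · rfl
  · rw [abs_of_neg (by linarith)]
    linarith

theorem bumpTraces_eq (hc0 : 0 < c) (hc : ∀ e, c ≤ Λ e) (hδ : 2 * δ ≤ c) (s : ℝ)
    (k' : N.WaveIndex) :
    N.bumpTraces Λ c η δ k s k' = (open Classical in
      if k' = k then oddBump δ (s - N.transportLength Λ k / 2) else 0) +
      ∑ l, N.transmissionMatrix (η (s - N.transportLength Λ k')) k' l *
        N.bumpTraces Λ c η δ k (s - N.transportLength Λ k') l :=
  delaySolution_eq hc0 (N.le_transportLength hc) (fun _ hs => bumpDatum_of_neg hc0 hc hδ hs) s k'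

theorem bumpTraces_of_lt (hc0 : 0 < c) (hc : ∀ e, c ≤ Λ e) (hδ : 2 * δ ≤ c) {s : ℝ}
    {k' : N.WaveIndex} (hs : s < N.transportLength Λ k') :
    N.bumpTraces Λ c η δ k s k' = open Classical in
      if k' = k then oddBump δ (s - N.transportLength Λ k / 2) else 0 := by
  rw [bumpTraces_eq hc0 hc hδ, add_eq_left]
  refine Finset.sum_eq_zero fun l _ => ?_
  rw [bumpTraces, delaySolution_of_neg hc0 (N.le_transportLength hc)
    (fun _ hs => bumpDatum_of_neg hc0 hc hδ hs) (by linarith), mul_zero]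

theorem isTraceFamily_bumpTraces (hc0 : 0 < c) (hc : ∀ e, c ≤ Λ e) (hδ0 : 0 < δ)
    (hδ : 2 * δ ≤ c) (hη : Measurable η) (hfin : (Set.range η).Finite) :
    N.IsTraceFamily Λ η (N.bumpTraces Λ c η δ k) := by
  classical
  let φ : SimpleFunc ℝ (N.damped → ℝ) :=
    ⟨η, fun v => hη (measurableSet_singleton v), hfin⟩
  have hbd : ∀ k l, ∃ b, ∀ s, ‖N.transmissionMatrix (η s) k l‖ ≤ b := fun k l =>
    (φ.map fun v => N.transmissionMatrix v k l).exists_forall_norm_le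
  choose b hb using hbd
  have hb' : ∀ s k l, ‖N.transmissionMatrix (η s) k l‖ ≤ ∑ k, ∑ l, b k l := fun s k l => by
    have h0 : ∀ k l, 0 ≤ b k l := fun k l => (norm_nonneg _).trans (hb k l 0)
    refine (hb k l s).trans ?_
    refine le_trans ?_ (Finset.single_le_sum (f := fun k => ∑ l, b k l)
      (fun k _ => Finset.sum_nonneg fun l _ => h0 k l) (Finset.mem_univ k))
    exact Finset.single_le_sum (f := fun l => b k l) (fun l _ => h0 k l) (Finset.mem_univ l)
  refine ⟨measurable_delaySolution hc0 (N.le_transportLength hc)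
      (fun _ hs => bumpDatum_of_neg hc0 hc hδ hs)
      (fun k l => (φ.map fun v => N.transmissionMatrix v k l).measurable) (fun k' => ?_),
    exists_bound_delaySolution hc0 (N.le_transportLength hc)
      (fun _ hs => bumpDatum_of_neg hc0 hc hδ hs) hb' (b' := δ) (fun s k' => ?_),
    fun s hs k' => ?_, fun k' => ?_⟩
  · split_ifs
    · exact (measurable_oddBump δ).comp (by fun_prop)
    · exact measurable_const
  · split_ifs
    · exact norm_oddBump_le hδ0 _
    · simpa using hδ0.le
  · rw [bumpTraces_eq hc0 hc hδ, add_sub_cancel_right]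
    have h0 : (if k' = k then oddBump δ (s + N.transportLength Λ k' -
        N.transportLength Λ k / 2) else 0) = 0 := by
      split_ifs with h
      · subst h
        have := N.le_transportLength hc k'
        rw [oddBump_of_le_abs]
        rw [abs_of_pos (by linarith)]
        linarith
      · rfl
    rw [h0, zero_add]
    rfl
  · have h1 : ∫ s in 0..N.transportLength Λ k', N.bumpTraces Λ c η δ k s k' =
        ∫ s in 0..N.transportLength Λ k', (if k' = k then
          oddBump δ (s - N.transportLength Λ k / 2) else 0) := by
      refine intervalIntegral.integral_congr_ae ?_
      filter_upwards [Measure.ae_ne volume (N.transportLength Λ k')] with s hs hmem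
      rw [Set.uIoc_of_le (hc0.le.trans (N.le_transportLength hc k'))] at hmem
      rw [bumpTraces_of_lt hc0 hc hδ (lt_of_le_of_ne hmem.2 hs)]
    rw [h1]
    split_ifs with h
    · subst h
      rw [intervalIntegral.integral_comp_sub_right (oddBump δ), zero_sub, sub_half,
        integral_oddBump]
    · simp

/-- Near the time `Λ·n + Λ_k / 2` the trace of the bump is the bump itself, multiplied by the
contribution of a unit datum. -/
theorem bumpTraces_eq_delaySum (hc0 : 0 < c) (hc : ∀ e, c ≤ Λ e) (hδ : 2 * δ ≤ c)
    {y : (N.Edge → ℕ) → N.damped → ℝ} {n : N.Edge → ℕ} {m : ℕ}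
    (hη : ∀ o : N.Edge → ℕ, (∀ e, o e ≤ m) → ∀ τ, |τ| < δ →
      η (N.orbitLength Λ n + N.transportLength Λ k / 2 - N.orbitLength Λ o + τ) = y o)
    (hsep : ∀ o : N.Edge → ℕ, (∀ e, o e ≤ m) → N.orbitLength Λ o ≠ N.orbitLength Λ n →
      2 * δ ≤ |N.orbitLength Λ o - N.orbitLength Λ n|)
    (hm : N.orbitLength Λ n + N.transportLength Λ k < m * c) {τ : ℝ} (hτ : |τ| < δ)
    (i : N.WaveIndex) :
    N.bumpTraces Λ c η δ k (N.orbitLength Λ n + N.transportLength Λ k / 2 + τ) i =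
      oddBump δ τ * delaySum N.orbitShift (fun o => N.transmissionMatrix (y o)) m
        (N.orbitDelta Λ n k) 0 i := by
  classical
  have hk := N.le_transportLength hc k
  have hτ' := abs_lt.1 hτ
  set T := N.orbitLength Λ n + N.transportLength Λ k / 2 with hT
  have h1 : oddBump δ τ * delaySum N.orbitShift (fun o => N.transmissionMatrix (y o)) m
        (N.orbitDelta Λ n k) 0 i = delaySum N.orbitShift (fun o => N.transmissionMatrix (y o)) m
        (oddBump δ τ • N.orbitDelta Λ n k) 0 i := by
    rw [map_smul]
    rfl
  rw [h1, bumpTraces, delaySolution_eq_delaySum hc0 (N.le_transportLength hc)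
    (fun _ hs => bumpDatum_of_neg hc0 hc hδ hs) (N := m) (by linarith), delaySum_apply, delaySum_apply]
  refine Finset.sum_congr rfl fun j hj => ?_
  have h0 : T + τ = T + τ - N.orbitLength Λ 0 := by rw [N.orbitLength_zero, sub_zero]
  conv_lhs => rw [h0]
  symm
  refine delayOp_pow_comp (fun o => T + τ - N.orbitLength Λ o) (fun k' o => ?_)
    (fun j => {o | ∀ e, o e ≤ j}) (fun j k' o ho e => ?_) m (fun j hj o ho => ?_)
    (fun j hj o ho => ?_) j 0 (by have := Finset.mem_range.1 hj; omega) 0 (fun e => le_rfl) i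
  · rw [N.orbitLength_shift, N.transportLength_eq]
    ring
  · rw [orbitShift, Pi.add_apply]
    have h2 : (Pi.single (N.waveEdge k') 1 : N.Edge → ℕ) e ≤ 1 := by
      rw [Pi.single_apply]
      split_ifs <;> simp
    exact add_le_add (ho e) h2
  · rw [← hη o (fun e => (ho e).trans hj) τ hτ, hT]
    congr 2
    ring
  · funext k'
    simp only [Pi.smul_apply, smul_eq_mul, orbitDelta]
    by_cases hk' : k' = k
    · by_cases ho' : N.orbitLength Λ o = N.orbitLength Λ n
      · rw [if_pos ⟨hk', ho'⟩, if_pos hk', mul_one, ho', hT]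
        congr 1
        ring
      · rw [if_neg fun h => ho' h.2, if_pos hk', mul_zero, oddBump_of_le_abs]
        have h2 := hsep o (fun e => (ho e).trans hj) ho'
        rw [show T + τ - N.orbitLength Λ o - N.transportLength Λ k / 2 =
          -((N.orbitLength Λ o - N.orbitLength Λ n) - τ) by rw [hT]; ring, abs_neg]
        have h3 := abs_sub_abs_le_abs_sub (N.orbitLength Λ o - N.orbitLength Λ n) τ
        linarith
    · rw [if_neg fun h => hk' h.1, if_neg hk', mul_zero]

end BumpTraces

theorem mem_switchingDampings {𝔇 : Set (N.damped → ℝ)} {η : ℝ → N.damped → ℝ} (hη : Measurable η)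
    (hfin : (Set.range η).Finite) (h : ∀ s, η s ∈ 𝔇) : η ∈ N.switchingDampings 𝔇 := by
  let _ : Fintype N.damped := Fintype.ofFinite _
  obtain ⟨C, hC⟩ := hfin.isBounded.exists_norm_le
  refine ⟨?_, Filter.Eventually.of_forall h⟩
  exact memLp_top_of_bound hη.aestronglyMeasurable C
    (Filter.Eventually.of_forall fun s => hC _ ⟨s, rfl⟩)

/-- A switching rule along the orbit issued from the time `T` is realized by a damping in
`L^∞(ℝ, 𝔇)` that is constant near the finitely many times `T - Λ·o` which are used. The last clause
separates the distinct lengths `Λ·o` from each other. -/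
theorem exists_damping_of_isOrbitSwitching {Λ : N.Edge → ℝ} {𝔇 : Set (N.damped → ℝ)}
    {y : (N.Edge → ℕ) → N.damped → ℝ} (hy : N.IsOrbitSwitching Λ 𝔇 y) (T : ℝ)
    (n : N.Edge → ℕ) (m : ℕ) {c : ℝ} (hc : 0 < c) :
    ∃ η : ℝ → N.damped → ℝ, Measurable η ∧ (Set.range η).Finite ∧ (∀ s, η s ∈ 𝔇) ∧
      ∃ δ, 0 < δ ∧ 2 * δ ≤ c ∧
        (∀ o : N.Edge → ℕ, (∀ e, o e ≤ m) → ∀ τ, |τ| < δ →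
          η (T - N.orbitLength Λ o + τ) = y o) ∧
        ∀ o : N.Edge → ℕ, (∀ e, o e ≤ m) → N.orbitLength Λ o ≠ N.orbitLength Λ n →
          2 * δ ≤ |N.orbitLength Λ o - N.orbitLength Λ n| := by
  classical
  set π : (N.Edge → ℕ) → ℝ := fun o => T - N.orbitLength Λ o with hπ
  have hyπ : ∀ o, (y ∘ Function.invFun π) (π o) = y o := fun o => by
    refine hy.2 _ _ ?_
    have h : π (Function.invFun π (π o)) = π o := Function.invFun_eq ⟨o, rfl⟩
    simp only [hπ] at h ⊢
    linarith
  set S := Fintype.piFinset fun _ : N.Edge => Finset.range (m + 1) with hS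
  have hmem : ∀ o : N.Edge → ℕ, (∀ e, o e ≤ m) → o ∈ S := fun o ho =>
    Fintype.mem_piFinset.2 fun e => Finset.mem_range.2 (Nat.lt_succ_of_le (ho e))
  obtain ⟨η, hηm, hηr, hη⟩ :=
    exists_measurable_eventuallyEq_const (y ∘ Function.invFun π) (y 0) (S.image π)
  refine ⟨η, hηm, ?_, fun s => ?_, ?_⟩
  · exact (((S.image π).finite_toSet.image _).insert _).subset (Set.range_subset_iff.2 hηr)
  · rcases hηr s with h | ⟨r, -, h⟩
    · rw [h]
      exact hy.1 _
    · rw [← h]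
      exact hy.1 _
  · have h1 : ∀ᶠ δ in nhdsWithin (0 : ℝ) (Set.Ioi 0), ∀ o ∈ S, ∀ τ, |τ| < δ →
        η (π o + τ) = y o := by
      rw [Filter.eventually_all_finset]
      intro o ho
      have h2 := hη (π o) (Finset.mem_image_of_mem π ho)
      rw [Metric.eventually_nhds_iff] at h2
      obtain ⟨ε, hε, h2⟩ := h2
      filter_upwards [Ioo_mem_nhdsGT hε] with δ hδ τ hτ
      rw [h2 (by rw [Real.dist_eq, add_sub_cancel_left]; exact hτ.trans hδ.2), hyπ]
    have h3 : ∀ᶠ δ in nhdsWithin (0 : ℝ) (Set.Ioi 0), ∀ o ∈ S,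
        N.orbitLength Λ o ≠ N.orbitLength Λ n →
          2 * δ ≤ |N.orbitLength Λ o - N.orbitLength Λ n| := by
      rw [Filter.eventually_all_finset]
      intro o _
      by_cases hne : N.orbitLength Λ o = N.orbitLength Λ n
      · exact Filter.Eventually.of_forall fun δ h => absurd hne h
      · have hpos : 0 < |N.orbitLength Λ o - N.orbitLength Λ n| / 2 :=
          half_pos (abs_pos.2 (sub_ne_zero.2 hne))
        filter_upwards [Ioo_mem_nhdsGT hpos] with δ hδ _
        linarith [hδ.2]
    obtain ⟨δ, hδ1, hδ3, hδc⟩ := (h1.and (h3.and (Ioo_mem_nhdsGT (half_pos hc)))).exists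
    exact ⟨δ, hδc.1, by linarith [hδc.2], fun o ho => hδ1 o (hmem o ho),
      fun o ho => hδ3 o (hmem o ho)⟩

/-- The data of the wave with the bump traces have the norm of the bump. -/
theorem sum_eLpNorm_dAlembert_bump_le {Λ : N.Edge → ℝ} {c δ : ℝ} {η : ℝ → N.damped → ℝ}
    {k : N.WaveIndex} (hc0 : 0 < c) (hc : ∀ e, c ≤ Λ e) (hδ : 2 * δ ≤ c)
    (hz : N.IsTraceFamily Λ η (N.bumpTraces Λ c η δ k)) (p : ℝ≥0∞) :
    ∑ k', eLpNorm (N.dAlembert Λ (N.waveOfTraces Λ (N.bumpTraces Λ c η δ k) 0) k') p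
      (edgeMeasure (N.transportLength Λ k')) ≤ eLpNorm (oddBump δ) p volume := by
  classical
  have hae : ∀ k', N.dAlembert Λ (N.waveOfTraces Λ (N.bumpTraces Λ c η δ k) 0) k'
      =ᵐ[edgeMeasure (N.transportLength Λ k')] fun x => if k' = k then
        oddBump δ (N.transportLength Λ k' - N.transportLength Λ k / 2 - x) else 0 := fun k' => by
    filter_upwards [hz.dAlembert_waveOfTraces 0 k', ae_restrict_of_ae (Measure.ae_ne volume 0),
      ae_restrict_mem measurableSet_Icc] with x hx hx0 hxm
    rw [hx, zero_add, bumpTraces_of_lt hc0 hc hδ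
      (sub_lt_self _ (lt_of_le_of_ne hxm.1 hx0.symm)), sub_right_comm]
  simp only [fun k' => eLpNorm_congr_ae (p := p) (hae k')]
  rw [Finset.sum_eq_single k]
  · simp only [if_true]
    refine (eLpNorm_mono_measure _ Measure.restrict_le_self).trans_eq ?_
    exact eLpNorm_comp_measurePreserving (memLp_oddBump δ p).1
      (Measure.measurePreserving_sub_left volume _)
  · intro k' _ hk'
    simp [hk']
  · simp

/-- The bump reaches the exit of the edge of the wave `i` in a window around the time `T`. At
the time `T - δ` the bump fills the last part of length `2δ` of the edge, so the norm of the state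
there controls the amplification factor `ρ`. -/
theorem enorm_mul_eLpNorm_oddBump_le {Λ : N.Edge → ℝ} {c δ T : ℝ} {η : ℝ → N.damped → ℝ}
    {k : N.WaveIndex} (hc : ∀ e, c ≤ Λ e) (hδ : 2 * δ ≤ c)
    (hz : N.IsTraceFamily Λ η (N.bumpTraces Λ c η δ k)) (p : ℝ≥0∞) {i : N.WaveIndex} {ρ : ℂ}
    (hρ : ∀ τ, |τ| < δ → N.bumpTraces Λ c η δ k (T + τ) i = oddBump δ τ * ρ) :
    ‖ρ‖ₑ * eLpNorm (oddBump δ) p volume ≤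
      eLpNorm (N.dAlembert Λ (N.waveOfTraces Λ (N.bumpTraces Λ c η δ k) (T - δ)) i) p
        (edgeMeasure (N.transportLength Λ i)) := by
  set ℓ := N.transportLength Λ i with hℓ
  have hcℓ : c ≤ ℓ := N.le_transportLength hc i
  have h1 : ‖ρ‖ₑ * eLpNorm (oddBump δ) p volume =
      eLpNorm (ρ • (oddBump δ ∘ fun x => ℓ - δ - x)) p (edgeMeasure ℓ) := by
    rw [edgeMeasure, ← eLpNorm_indicator_eq_eLpNorm_restrict measurableSet_Icc,
      Set.indicator_eq_self.2, eLpNorm_const_smul,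
      eLpNorm_comp_measurePreserving (memLp_oddBump δ p).1
        (Measure.measurePreserving_sub_left volume _)]
    intro x hx
    have h2 : |ℓ - δ - x| < δ := by
      by_contra h
      exact hx (by simp [oddBump_of_le_abs (not_lt.1 h)])
    have h3 := abs_lt.1 h2
    exact ⟨by linarith, by linarith⟩
  rw [h1, eLpNorm_congr_ae (hz.dAlembert_waveOfTraces (T - δ) i)]
  refine eLpNorm_mono fun x => ?_
  rcases lt_or_ge |ℓ - δ - x| δ with h | h
  · rw [show T - δ + ℓ - x = T + (ℓ - δ - x) by ring, hρ _ h, mul_comm]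
    rfl
  · simp [oddBump_of_le_abs h]

theorem hasOrbitDecay_of_isExponentiallyStable {Λ : N.Edge → ℝ} (hΛ : ∀ e, 0 < Λ e)
    {𝔇 : Set (N.damped → ℝ)} {p : ℝ≥0∞} (hp : 1 ≤ p)
    (h : N.IsExponentiallyStable Λ p (N.switchingDampings 𝔇)) :
    ∃ C κ, 0 ≤ C ∧ κ < 0 ∧ N.HasOrbitDecay Λ 𝔇 C κ := by
  obtain ⟨γ, hγ, hγ'⟩ := h
  obtain ⟨K, hK, hstab⟩ := hγ' (-γ / 2) (by linarith)
  rw [show γ + -γ / 2 = γ / 2 by ring] at hstab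
  obtain ⟨c, hc0, hc⟩ := N.exists_pos_le hΛ
  refine ⟨4 * K, γ / 2, by linarith, by linarith, fun n k => ?_⟩
  obtain ⟨m₀, hm₀⟩ := exists_nat_gt ((N.orbitLength Λ n + N.transportLength Λ k) / c)
  rw [div_lt_iff₀ hc0] at hm₀
  refine ⟨m₀, fun m hm y hy i => ?_⟩
  have hm' : N.orbitLength Λ n + N.transportLength Λ k < m * c := by
    have : (m₀ : ℝ) ≤ m := by exact_mod_cast hm
    exact hm₀.trans_le (mul_le_mul_of_nonneg_right this hc0.le)
  set T := N.orbitLength Λ n + N.transportLength Λ k / 2 with hT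
  obtain ⟨η, hηm, hηfin, hη𝔇, δ, hδ0, hδ, hη, hsep⟩ :=
    N.exists_damping_of_isOrbitSwitching hy T n m hc0
  have hz : N.IsTraceFamily Λ η (N.bumpTraces Λ c η δ k) :=
    isTraceFamily_bumpTraces hc0 hc hδ0 hδ hηm hηfin
  set ρ := delaySum N.orbitShift (fun o => N.transmissionMatrix (y o)) m
    (N.orbitDelta Λ n k) 0 i
  have hT0 : N.orbitLength Λ n ≤ T - δ := by linarith [N.le_transportLength hc k]
  have hT1 : 0 ≤ T - δ := (N.orbitLength_nonneg hΛ n).trans hT0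
  set W := N.waveOfTraces Λ (N.bumpTraces Λ c η δ k) with hW
  have hsol := hstab η (N.mem_switchingDampings hηm hηfin hη𝔇) (W 0)
    (hz.waveOfTraces_mem hΛ le_rfl p) W (hz.isWaveSolution hΛ p) (T - δ) hT1
  have hbump : ‖ρ‖ₑ * eLpNorm (oddBump δ) p volume ≤
      ENNReal.ofReal (4 * K * Real.exp (γ / 2 * N.orbitLength Λ n)) *
        eLpNorm (oddBump δ) p volume := by
    calc ‖ρ‖ₑ * eLpNorm (oddBump δ) p volume
        ≤ eLpNorm (N.dAlembert Λ (W (T - δ)) i) p (edgeMeasure (N.transportLength Λ i)) :=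
          N.enorm_mul_eLpNorm_oddBump_le hc hδ hz p fun τ hτ =>
            bumpTraces_eq_delaySum hc0 hc hδ hη hsep hm' hτ i
      _ ≤ 2 * N.waveNorm Λ p (W (T - δ)) :=
          N.eLpNorm_dAlembert_le hp (hz.waveOfTraces_mem hΛ hT1 p) i
      _ ≤ 2 * (ENNReal.ofReal (K * Real.exp (γ / 2 * (T - δ))) *
            (2 * eLpNorm (oddBump δ) p volume)) := by
          refine mul_le_mul_right (hsol.trans (mul_le_mul_right ?_ _)) _
          exact (N.waveNorm_le_dAlembert hp (hz.waveOfTraces_mem hΛ le_rfl p)).trans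
            (mul_le_mul_right (N.sum_eLpNorm_dAlembert_bump_le hc0 hc hδ hz p) _)
      _ = ENNReal.ofReal (4 * (K * Real.exp (γ / 2 * (T - δ)))) *
            eLpNorm (oddBump δ) p volume := by
          rw [ENNReal.ofReal_mul (p := 4) (by norm_num),
            show ENNReal.ofReal 4 = 2 * 2 by norm_num]
          ring
      _ ≤ _ := by
          refine mul_le_mul_left (ENNReal.ofReal_le_ofReal ?_) _
          rw [← mul_assoc]
          refine mul_le_mul_of_nonneg_left (Real.exp_le_exp.2 ?_) (by linarith)
          exact mul_le_mul_of_nonpos_left hT0 (by linarith)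
  rw [ENNReal.mul_le_mul_iff_left (eLpNorm_oddBump_ne_zero hδ0 (one_pos.trans_le hp).ne')
    (memLp_oddBump δ p).2.ne, ← ofReal_norm, ENNReal.ofReal_le_ofReal_iff (by positivity)] at hbump
  exact hbump

end WaveGraph

end

theorem mainTheorem2 {V : Type*} [Fintype V] (N : WaveGraph V)
    (Λ : N.Edge → ℝ) (hΛ : ∀ e, 0 < Λ e)
    (𝔇 : Set (N.damped → ℝ)) (h𝔇 : ∀ d ∈ 𝔇, ∀ q, 0 ≤ d q) :
    (∃ p : ENNReal, 1 ≤ p ∧ N.IsExponentiallyStable Λ p (N.switchingDampings 𝔇)) ↔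
      ∀ L ∈ VPlus Λ, ∀ p : ENNReal, 1 ≤ p →
        N.IsExponentiallyStable L p (N.switchingDampings 𝔇) := by
  constructor
  · rintro ⟨p, hp, h⟩ L hL p' hp'
    obtain ⟨C, κ, hC, hκ, hdecay⟩ := N.hasOrbitDecay_of_isExponentiallyStable hΛ hp h
    exact N.isExponentiallyStable_of_hasOrbitDecay hΛ hL hC hκ hdecay hp'
  · intro h
    exact ⟨1, le_rfl, h Λ ⟨Set.Subset.rfl, hΛ⟩ 1 le_rfl⟩
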